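/- For an integer vector $\mathbf x=(x_1,\dots,x_n)$ let $\|\mathbf x\|_2$ be its Euclidean norm, and let its bit length be the total number of binary digits of $|x_1|,\dots,|x_n|$. There is a deterministic algorithm (a single program for a random access machine on integers, with running time measured in bit operations, that is, with logarithmic cost) that takes a vector $\mathbf x\in\mathbb Z^n$ as input and has the following property for all integers $n\ge 2$, all nonzero $\mathbf x\in\mathbb Z^n$ and all integers $d\ge 0$: if $$d > 2^{\frac{n-2}{4}}\left(\frac{\|\mathbf x\|_2}{\gcd(x_1,\dots,x_n)}\right)^{\frac1{n-1}}-1,$$ then, on input $\mathbf x$, the algorithm halts in time polynomial in $n$ and the bit length of $\mathbf x$ (the polynomial not depending on $n$, $\mathbf x$ or $d$) and outputs a nonzero vector $\mathbf c\in\{-d,-d+1,\dots,d\}^n$ with $\mathbf c\cdot\mathbf x=\sum_{i=1}^n c_ix_i=0$. -/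

import Mathlib

/-! A deterministic random access machine over the integers with bit (logarithmic) cost,
programmed by structured programs. -/

namespace RAM

/-- Number of binary digits of `|z|`. -/
def bitSize (z : ℤ) : ℕ := Nat.size z.natAbs

/-- Total number of binary digits of the entries of an integer vector. -/
def bitLength {n : ℕ} (x : Fin n → ℤ) : ℕ := ∑ i, bitSize (x i)

/-- The memory: integer variables and integer arrays. A program mentions only finitely many
variable names and array names; an array cell is addressed by a computed integer. -/
structure State where
  var : ℕ → ℤ
  arr : ℕ → ℤ → ℤ

namespace State

/-- Overwrite the variable `v` by `z`. -/
def setVar (s : State) (v : ℕ) (z : ℤ) : State :=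
  { s with var := Function.update s.var v z }

/-- Overwrite the cell with address `i` of the array `a` by `z`. -/
def setArr (s : State) (a : ℕ) (i z : ℤ) : State :=
  { s with arr := Function.update s.arr a (Function.update (s.arr a) i z) }

end State

/-- The arithmetic operations and the comparisons. -/
inductive Op
  | add | sub | mul | div | lt | eq

/-- The value of an operation. Division is division with remainder (with value `0` for the
divisor `0`); comparisons return `1` or `0`. -/
def Op.eval : Op → ℤ → ℤ → ℤ
  | .add, a, b => a + b
  | .sub, a, b => a - b
  | .mul, a, b => a * b
  | .div, a, b => a / b
  | .lt, a, b => if a < b then 1 else 0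
  | .eq, a, b => if a = b then 1 else 0

/-- Expressions: constants, variables, array cells, operations. -/
inductive Expr
  | const (k : ℤ)
  | var (v : ℕ)
  | read (a : ℕ) (i : Expr)
  | op (o : Op) (e f : Expr)

namespace Expr

/-- The value of an expression. -/
def eval (s : State) : Expr → ℤ
  | const k => k
  | var v => s.var v
  | read a i => s.arr a (i.eval s)
  | op o e f => o.eval (e.eval s) (f.eval s)

/-- The number of bit operations charged for evaluating an expression: an access costs the
number of bits of the address and of the datum, and an operation on integers of `k` and `l` bits
costs `(k + 1) * (l + 1)`, the cost of schoolbook multiplication and division. -/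
def cost (s : State) : Expr → ℕ
  | const k => bitSize k + 1
  | var v => bitSize (s.var v) + 1
  | read a i => i.cost s + bitSize (i.eval s) + bitSize (s.arr a (i.eval s)) + 1
  | op _ e f => e.cost s + f.cost s + (bitSize (e.eval s) + 1) * (bitSize (f.eval s) + 1)

end Expr

/-- Programs. -/
inductive Prog
  | skip
  | assign (v : ℕ) (e : Expr)
  | store (a : ℕ) (i e : Expr)
  | seq (p q : Prog)
  | ite (b : Expr) (p q : Prog)
  | loop (b : Expr) (p : Prog)

/-- `Exec p s s' t`: the program `p`, started in the state `s`, halts in the state `s'` after `t`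
units of time. A test `b` counts as true when its value is not `0`; `loop b p` is
"while `b` do `p`". -/
inductive Exec : Prog → State → State → ℕ → Prop
  | skip (s : State) : Exec .skip s s 1
  | assign (s : State) (v : ℕ) (e : Expr) :
      Exec (.assign v e) s (s.setVar v (e.eval s)) (e.cost s + bitSize (e.eval s) + 1)
  | store (s : State) (a : ℕ) (i e : Expr) :
      Exec (.store a i e) s (s.setArr a (i.eval s) (e.eval s))
        (i.cost s + e.cost s + bitSize (i.eval s) + bitSize (e.eval s) + 1)
  | seq {p q : Prog} {s s₁ s₂ : State} {t₁ t₂ : ℕ} :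
      Exec p s s₁ t₁ → Exec q s₁ s₂ t₂ → Exec (.seq p q) s s₂ (t₁ + t₂)
  | iteTrue {b : Expr} {p q : Prog} {s s₁ : State} {t : ℕ} :
      b.eval s ≠ 0 → Exec p s s₁ t → Exec (.ite b p q) s s₁ (b.cost s + 1 + t)
  | iteFalse {b : Expr} {p q : Prog} {s s₁ : State} {t : ℕ} :
      b.eval s = 0 → Exec q s s₁ t → Exec (.ite b p q) s s₁ (b.cost s + 1 + t)
  | loopTrue {b : Expr} {p : Prog} {s s₁ s₂ : State} {t₁ t₂ : ℕ} :
      b.eval s ≠ 0 → Exec p s s₁ t₁ → Exec (.loop b p) s₁ s₂ t₂ →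
        Exec (.loop b p) s s₂ (b.cost s + 1 + t₁ + t₂)
  | loopFalse {b : Expr} {p : Prog} {s : State} :
      b.eval s = 0 → Exec (.loop b p) s s (b.cost s + 1)

/-- The machine is deterministic: final state and running time are determined by the program
and the initial state. -/
theorem Exec.deterministic {p : Prog} {s s₁ s₂ : State} {t₁ t₂ : ℕ}
    (h₁ : Exec p s s₁ t₁) (h₂ : Exec p s s₂ t₂) : s₁ = s₂ ∧ t₁ = t₂ := by
  induction h₁ generalizing s₂ t₂ with
  | skip | assign | store => cases h₂; exact ⟨rfl, rfl⟩
  | seq _ _ ih₁ ih₂ =>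
    cases h₂ with
    | seq k₁ k₂ =>
      obtain ⟨rfl, rfl⟩ := ih₁ k₁
      obtain ⟨rfl, rfl⟩ := ih₂ k₂
      exact ⟨rfl, rfl⟩
  | iteTrue hb _ ih | iteFalse hb _ ih =>
    cases h₂ with
    | iteTrue hb' k =>
      first
      | (obtain ⟨rfl, rfl⟩ := ih k; exact ⟨rfl, rfl⟩)
      | exact absurd hb hb'
    | iteFalse hb' k =>
      first
      | (obtain ⟨rfl, rfl⟩ := ih k; exact ⟨rfl, rfl⟩)
      | exact absurd hb' hb
  | loopTrue hb _ _ ih₁ ih₂ =>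
    cases h₂ with
    | loopTrue _ k₁ k₂ =>
      obtain ⟨rfl, rfl⟩ := ih₁ k₁
      obtain ⟨rfl, rfl⟩ := ih₂ k₂
      exact ⟨rfl, rfl⟩
    | loopFalse hb' => exact absurd hb' hb
  | loopFalse hb =>
    cases h₂ with
    | loopTrue hb' _ _ => exact absurd hb hb'
    | loopFalse _ => exact ⟨rfl, rfl⟩

/-- The initial state for the input vector `x`: the variable `0` holds the dimension `n`, the
cells `0, …, n - 1` of the array `0` hold the entries of `x`, everything else is `0`. -/
def input {n : ℕ} (x : Fin n → ℤ) : State where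
  var v := if v = 0 then (n : ℤ) else 0
  arr a i := if h : a = 0 ∧ 0 ≤ i ∧ i < n then x ⟨i.toNat, by omega⟩ else 0

/-- The output vector: the cells `0, …, n - 1` of the array `1`. -/
def output (n : ℕ) (s : State) : Fin n → ℤ := fun i => s.arr 1 (i : ℕ)

end RAM

/-!
The program runs the all-integer form of the basis reduction algorithm of Lenstra, Lenstra and
Lovász on the lattice generated by the vectors `(e_i, √Γ x_i)`, where `Γ = 4 ^ n (1 + ‖x‖²)`, and
returns the first `n` coordinates of the first reduced basis vector.

*Data.* A single integer matrix (`LLL.IsBasisData`) holds the coordinates of the basis vectors and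
the numbers `d_j μ_{ij}`, where `μ_{ij}` are the Gram–Schmidt coefficients and `d_j` is the Gram
determinant of the first `j` vectors. These numbers are determined by the identity
`⟨b_i, b_j⟩ = ∑ l, (d_l μ_{il}) (d_l μ_{jl}) / (d_{l-1} d_l)`, and they are integers because they are
minors of the Gram matrix (`LLL.exists_int_of_scaledForm`). For the initial basis they have the
closed form `Γ x_i x_j` (`LLL.isBasisData_initData`). Size reduction is a row operation, and the
exchange of two neighbouring vectors is an exchange of rows followed by an exact `2 × 2` operation
on columns (`LLL.IsBasisData.subRow`, `LLL.IsBasisData.swapStep`).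

*Output.* Let `b_i*` be the orthogonal components, so that `‖b_i*‖² = d_i / d_{i-1}`. By the Lovász
conditions `‖b_i*‖² ≤ 2 ‖b_{i+1}*‖²`. The first basis vector that is not orthogonal to `x` has
`‖b_j*‖² ≥ Γ`; since the volume `d_n = 1 + Γ ‖x‖²` is invariant, only the last vector can be of this
kind (`LLL.orthogonal_of_reduced`). Comparing `‖b_n*‖²` with `d_n` gives `d_{n-1} ≤ ‖x‖² / g²`, where
`g` is the greatest common divisor of the entries of `x` (`LLL.sq_mul_diag_le`). Hence
`‖b_1‖^(2(n-1)) ≤ 2 ^ ((n-1)(n-2)/2) d_{n-1}`, which is the required bound (`LLL.coord_pow_le`).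

*Time.* The `d_i` never increase, and between rounds the squared lengths of all basis vectors are at
most `n d_n`, which bounds all entries (`LLL.IsBasisData.abs_le`); within a size reduction the entries
grow by a bounded factor for each of at most `n` row operations. Each exchange multiplies the product
of the `d_i` by less than `3 / 4`, which bounds the number of rounds (`LLL.level_swapStep_lt`). The
cost calculus `RAM.Runs` turns a bound for the number of rounds of the loops and a bound `S` for the
length of all numbers in the memory into a bound for the bit complexity.
-/

/-! ### A cost calculus for structured programs -/

namespace RAM

theorem bitSize_le_iff {z : ℤ} {S : ℕ} : bitSize z ≤ S ↔ |z| < 2 ^ S := by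
  unfold bitSize
  rw [Nat.size_le, ← Int.natCast_natAbs]
  exact_mod_cast Iff.rfl

theorem abs_lt_two_pow_bitSize (z : ℤ) : |z| < 2 ^ bitSize z :=
  bitSize_le_iff.1 le_rfl

theorem bitSize_add_le (a b : ℤ) : bitSize (a + b) ≤ bitSize a + bitSize b + 1 := by
  rw [bitSize_le_iff]
  have ha := abs_lt_two_pow_bitSize a
  have hb := abs_lt_two_pow_bitSize b
  have h1 : (2 : ℤ) ^ bitSize a ≤ 2 ^ (bitSize a + bitSize b) :=
    pow_le_pow_right₀ (by norm_num) (by omega)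
  have h2 : (2 : ℤ) ^ bitSize b ≤ 2 ^ (bitSize a + bitSize b) :=
    pow_le_pow_right₀ (by norm_num) (by omega)
  rw [pow_succ]
  linarith [abs_add_le a b]

theorem bitSize_neg (a : ℤ) : bitSize (-a) = bitSize a := by
  simp [bitSize]

theorem bitSize_mul_le (a b : ℤ) : bitSize (a * b) ≤ bitSize a + bitSize b := by
  rw [bitSize_le_iff, abs_mul, pow_add]
  exact mul_lt_mul'' (abs_lt_two_pow_bitSize a) (abs_lt_two_pow_bitSize b) (abs_nonneg _)
    (abs_nonneg _)

theorem abs_ediv_le_abs (a b : ℤ) : |a / b| ≤ |a| := by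
  rw [Int.abs_eq_natAbs, Int.abs_eq_natAbs]
  exact_mod_cast Int.natAbs_ediv_le_natAbs a b

theorem bitSize_op_le (o : Op) (a b : ℤ) : bitSize (o.eval a b) ≤ bitSize a + bitSize b + 1 := by
  cases o with
  | add => exact bitSize_add_le a b
  | sub =>
    have := bitSize_add_le a (-b)
    rwa [bitSize_neg, ← sub_eq_add_neg] at this
  | mul => exact (bitSize_mul_le a b).trans (Nat.le_succ _)
  | div =>
    refine le_trans ?_ (show bitSize a ≤ bitSize a + bitSize b + 1 by omega)
    rw [bitSize_le_iff]
    exact (abs_ediv_le_abs a b).trans_lt (abs_lt_two_pow_bitSize a)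
  | lt => simp only [Op.eval]; split_ifs <;> simp [bitSize]
  | eq => simp only [Op.eval]; split_ifs <;> simp [bitSize]

/-- Every memory cell holds an integer of at most `S` bits. -/
def State.Bdd (S : ℕ) (s : State) : Prop :=
  (∀ v, bitSize (s.var v) ≤ S) ∧ ∀ a i, bitSize (s.arr a i) ≤ S

/-- A factor such that the value of the expression has at most `e.height * (S + 1)` bits in every
state whose cells have at most `S` bits. -/
def Expr.height : Expr → ℕ
  | const k => bitSize k + 1
  | var _ => 1
  | read _ _ => 1
  | op _ e f => e.height + f.height + 1

/-- A factor such that evaluating the expression costs at most `e.wt * (S + 1) ^ 2` in every state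
whose cells have at most `S` bits. -/
def Expr.wt : Expr → ℕ
  | const k => bitSize k + 1
  | var _ => 1
  | read _ i => i.wt + i.height + 1
  | op _ e f => e.wt + f.wt + (e.height + 1) * (f.height + 1)

theorem Expr.bitSize_eval_le {S : ℕ} {s : State} (h : s.Bdd S) (e : Expr) :
    bitSize (e.eval s) ≤ e.height * (S + 1) := by
  induction e with
  | const k => simp only [eval, height]; nlinarith
  | var v => simp only [eval, height]; linarith [h.1 v]
  | read a i => simp only [eval, height]; linarith [h.2 a (i.eval s)]
  | op o e f he hf =>
    simp only [eval, height]
    have := bitSize_op_le o (e.eval s) (f.eval s)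
    nlinarith

theorem Expr.cost_le {S : ℕ} {s : State} (h : s.Bdd S) (e : Expr) :
    e.cost s ≤ e.wt * (S + 1) ^ 2 := by
  have h1 : 1 ≤ (S + 1) ^ 2 := Nat.one_le_pow _ _ (by omega)
  have h2 : S + 1 ≤ (S + 1) ^ 2 := by nlinarith
  induction e with
  | const k => simp only [cost, wt]; nlinarith
  | var v => simp only [cost, wt]; linarith [h.1 v]
  | read a i hi =>
    simp only [cost, wt]
    have := h.2 a (i.eval s)
    have := Expr.bitSize_eval_le h i
    nlinarith
  | op o e f he hf =>
    simp only [cost, wt]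
    have h3 : bitSize (e.eval s) + 1 ≤ (e.height + 1) * (S + 1) := by
      linarith [Expr.bitSize_eval_le h e]
    have h4 : bitSize (f.eval s) + 1 ≤ (f.height + 1) * (S + 1) := by
      linarith [Expr.bitSize_eval_le h f]
    have := Nat.mul_le_mul h3 h4
    nlinarith

/-- The weight of a program: up to the factor `(S + 1) ^ 2`, a bound for the time of a run which
passes through every loop body at most once and keeps all cells below `S` bits. -/
def Prog.wt : Prog → ℕ
  | skip => 1
  | assign _ e => e.wt + e.height + 1
  | store _ i e => i.wt + e.wt + i.height + e.height + 1
  | seq p q => p.wt + q.wt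
  | ite b p q => b.wt + 1 + p.wt + q.wt
  | loop b p => b.wt + 1 + p.wt

/-- Started in `s`, a state with cells of at most `S` bits, the program `p` halts in a state with
cells of at most `S` bits that satisfies `Q`, and no statement of `p` is executed more than about
`K` times, in the sense that the time is at most `K * p.wt * (S + 1) ^ 2`. -/
def Runs (S K : ℕ) (p : Prog) (s : State) (Q : State → Prop) : Prop :=
  s.Bdd S → ∃ s' t, Exec p s s' t ∧ t ≤ K * p.wt * (S + 1) ^ 2 ∧ s'.Bdd S ∧ Q s'

variable {S K : ℕ} {p q : Prog} {s : State} {Q : State → Prop}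

theorem Runs.mono {K' : ℕ} {Q' : State → Prop} (h : Runs S K p s Q) (hK : K ≤ K')
    (hQ : ∀ s', Q s' → Q' s') : Runs S K' p s Q' := by
  intro hs
  obtain ⟨s', t, he, ht, hb, hq⟩ := h hs
  exact ⟨s', t, he, ht.trans (by gcongr), hb, hQ _ hq⟩

theorem Runs.skip (hK : 1 ≤ K) (h : Q s) : Runs S K .skip s Q := by
  intro hs
  refine ⟨s, 1, .skip s, ?_, hs, h⟩
  have h1 : 1 ≤ (S + 1) ^ 2 := Nat.one_le_pow _ _ (by omega)
  simp only [Prog.wt]; nlinarith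

theorem State.Bdd.setVar (h : s.Bdd S) {v : ℕ} {z : ℤ} (hz : |z| < 2 ^ S) :
    (s.setVar v z).Bdd S := by
  refine ⟨fun w => ?_, h.2⟩
  simp only [State.setVar, Function.update_apply]
  split_ifs
  · exact bitSize_le_iff.2 hz
  · exact h.1 w

theorem State.Bdd.setArr (h : s.Bdd S) {a : ℕ} {i z : ℤ} (hz : |z| < 2 ^ S) :
    (s.setArr a i z).Bdd S := by
  refine ⟨h.1, fun b j => ?_⟩
  simp only [State.setArr, Function.update_apply]
  split_ifs with h1
  · rw [Function.update_apply]
    split_ifs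
    · exact bitSize_le_iff.2 hz
    · exact h.2 _ _
  · exact h.2 _ _

theorem Runs.assign {v : ℕ} {e : Expr} (hK : 1 ≤ K) (he : |e.eval s| < 2 ^ S)
    (h : Q (s.setVar v (e.eval s))) : Runs S K (.assign v e) s Q := by
  intro hs
  refine ⟨_, _, .assign s v e, ?_, hs.setVar he, h⟩
  have h1 := e.cost_le hs
  have h2 := e.bitSize_eval_le hs
  have h3 : e.cost s + bitSize (e.eval s) + 1 ≤ (e.wt + e.height + 1) * (S + 1) ^ 2 := by
    nlinarith
  simp only [Prog.wt]
  calc _ ≤ _ := h3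
    _ = 1 * (e.wt + e.height + 1) * (S + 1) ^ 2 := by ring
    _ ≤ _ := by gcongr

theorem Runs.store {a : ℕ} {i e : Expr} (hK : 1 ≤ K) (he : |e.eval s| < 2 ^ S)
    (h : Q (s.setArr a (i.eval s) (e.eval s))) : Runs S K (.store a i e) s Q := by
  intro hs
  refine ⟨_, _, .store s a i e, ?_, hs.setArr he, h⟩
  have h1 := e.cost_le hs
  have h2 := e.bitSize_eval_le hs
  have h1' := i.cost_le hs
  have h2' := i.bitSize_eval_le hs
  have h3 : i.cost s + e.cost s + bitSize (i.eval s) + bitSize (e.eval s) + 1 ≤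
      (i.wt + e.wt + i.height + e.height + 1) * (S + 1) ^ 2 := by
    nlinarith
  simp only [Prog.wt]
  calc _ ≤ _ := h3
    _ = 1 * (i.wt + e.wt + i.height + e.height + 1) * (S + 1) ^ 2 := by ring
    _ ≤ _ := by gcongr

theorem Runs.seq (h : Runs S K p s fun s₁ => Runs S K q s₁ Q) : Runs S K (.seq p q) s Q := by
  intro hs
  obtain ⟨s₁, t₁, he₁, ht₁, hb₁, h₁⟩ := h hs
  obtain ⟨s₂, t₂, he₂, ht₂, hb₂, h₂⟩ := h₁ hb₁
  refine ⟨s₂, _, .seq he₁ he₂, ?_, hb₂, h₂⟩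
  simp only [Prog.wt]
  nlinarith

theorem Expr.cost_succ_le (hs : s.Bdd S) (b : Expr) (hK : 1 ≤ K) :
    b.cost s + 1 ≤ K * (b.wt + 1) * (S + 1) ^ 2 := by
  have h1 := b.cost_le hs
  have h2 : 1 ≤ (S + 1) ^ 2 := Nat.one_le_pow _ _ (by omega)
  calc b.cost s + 1 ≤ 1 * (b.wt + 1) * (S + 1) ^ 2 := by nlinarith
    _ ≤ _ := by gcongr

theorem Runs.ite {b : Expr} (hK : 1 ≤ K) (h₁ : b.eval s ≠ 0 → Runs S K p s Q)
    (h₂ : b.eval s = 0 → Runs S K q s Q) : Runs S K (.ite b p q) s Q := by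
  intro hs
  have hc := b.cost_succ_le hs hK
  by_cases hb : b.eval s = 0
  · obtain ⟨s', t, he, ht, hb', h⟩ := h₂ hb hs
    refine ⟨s', _, .iteFalse hb he, ?_, hb', h⟩
    simp only [Prog.wt]
    have : 0 ≤ K * p.wt * (S + 1) ^ 2 := by positivity
    nlinarith
  · obtain ⟨s', t, he, ht, hb', h⟩ := h₁ hb hs
    refine ⟨s', _, .iteTrue hb he, ?_, hb', h⟩
    simp only [Prog.wt]
    have : 0 ≤ K * q.wt * (S + 1) ^ 2 := by positivity
    nlinarith

/-- A loop with invariant `I` and variant `f`. -/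
theorem Runs.loop {b : Expr} (I : State → Prop) (f : State → ℕ) {m : ℕ} (hK : 1 ≤ K)
    (hstep : ∀ s, I s → b.eval s ≠ 0 → Runs S K p s fun s' => I s' ∧ f s' < f s)
    (hI : I s) (hm : f s < m) (hQ : ∀ s', I s' → b.eval s' = 0 → Q s') :
    Runs S (K * m) (.loop b p) s Q := by
  induction m generalizing s with
  | zero => omega
  | succ m ih =>
    intro hs
    have hc := b.cost_succ_le hs hK
    by_cases hb : b.eval s = 0
    · refine ⟨s, _, .loopFalse hb, ?_, hs, hQ _ hI hb⟩
      simp only [Prog.wt]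
      calc _ ≤ _ := hc
        _ ≤ K * (m + 1) * (b.wt + 1 + p.wt) * (S + 1) ^ 2 := by
          have : K ≤ K * (m + 1) := Nat.le_mul_of_pos_right _ (by omega)
          gcongr ?_ * ?_ * _
          omega
    · obtain ⟨s₁, t₁, he₁, ht₁, hb₁, hI₁, hf⟩ := hstep s hI hb hs
      obtain ⟨s₂, t₂, he₂, ht₂, hb₂, h⟩ := ih hI₁ (by omega) hb₁
      refine ⟨s₂, _, .loopTrue hb he₁ he₂, ?_, hb₂, h⟩
      simp only [Prog.wt] at ht₂ ⊢
      nlinarith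

/-- `for v := lo, …, hi - 1 do p`, where `hi` is evaluated anew in each round. -/
def forLoop (v : ℕ) (lo hi : Expr) (p : Prog) : Prog :=
  .seq (.assign v lo)
    (.loop (.op .lt (.var v) hi) (.seq p (.assign v (.op .add (.var v) (.const 1)))))

/-- A `for` loop with the invariant `J i` before the round with counter `i`. -/
theorem Runs.forLoop {v : ℕ} {lo hi : Expr} (J : ℕ → State → Prop) {a b m : ℕ} (hK : 1 ≤ K)
    (hlo : lo.eval s = a) (hab : a ≤ b) (hbS : b < 2 ^ S) (hm : b < m)
    (hJ : ∀ i s, J i s → s.var v = i ∧ hi.eval s = b)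
    (h0 : J a (s.setVar v a))
    (hstep : ∀ i s, a ≤ i → i < b → J i s →
      Runs S K p s fun s' => s'.var v = i ∧ J (i + 1) (s'.setVar v ((i + 1 : ℕ) : ℤ)))
    (hQ : ∀ s', J b s' → Q s') :
    Runs S (K * m) (forLoop v lo hi p) s Q := by
  have key : ∀ i : ℕ, i ≤ b → |(i : ℤ)| < 2 ^ S := fun i hi => by
    rw [Nat.abs_cast]; exact_mod_cast hi.trans_lt hbS
  refine Runs.seq (Runs.assign (by nlinarith) (by rw [hlo]; exact key a hab) ?_)
  rw [hlo]
  refine Runs.loop (fun s => ∃ i, a ≤ i ∧ i ≤ b ∧ J i s) (fun s => b - (s.var v).toNat) hK ?_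
    ⟨a, le_rfl, hab, h0⟩ (by omega) ?_
  · rintro s ⟨i, hai, hib, h⟩ hb
    obtain ⟨hv, hhi⟩ := hJ i s h
    have hlt : i < b := by
      by_contra hc
      apply hb
      simp [Expr.eval, Op.eval, hv, hhi, hc]
    refine Runs.seq ((hstep i s hai hlt h).mono le_rfl ?_)
    rintro s' ⟨hv', h'⟩
    have he : (Expr.op .add (.var v) (.const 1)).eval s' = ((i + 1 : ℕ) : ℤ) := by
      simp [Expr.eval, Op.eval, hv']
    refine Runs.assign hK (by rw [he]; exact key _ hlt) ?_
    rw [he]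
    refine ⟨⟨i + 1, by omega, hlt, h'⟩, ?_⟩
    have := (hJ _ _ h').1
    rw [this, hv]
    omega
  · rintro s' ⟨i, hai, hib, h⟩ hb
    obtain ⟨hv, hhi⟩ := hJ i s' h
    have : i = b := by
      by_contra hc
      have : i < b := by omega
      simp [Expr.eval, Op.eval, hv, hhi, this] at hb
    exact hQ _ (this ▸ h)

end RAM

/-! ### Integral Gram–Schmidt data -/

namespace LLL

open Finset

/-- The bilinear form `∑ u_{l+1} v_{l+1} / (d_l d_{l+1})`, in which the rows of the integral
Gram–Schmidt coefficients `d_j μ_{ij}` have the inner products of the lattice basis. -/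
def scaledForm (n : ℕ) (d : ℕ → ℚ) (u v : ℕ → ℚ) : ℚ :=
  ∑ l ∈ range n, u (l + 1) * v (l + 1) / (d l * d (l + 1))

theorem scaledForm_comm (n : ℕ) (d u v : ℕ → ℚ) : scaledForm n d u v = scaledForm n d v u := by
  simp only [scaledForm, mul_comm]

theorem scaledForm_sub_smul_left (n : ℕ) (d u v w : ℕ → ℚ) (q : ℚ) :
    scaledForm n d (u - q • v) w = scaledForm n d u w - q * scaledForm n d v w := by
  simp only [scaledForm, mul_sum, ← sum_sub_distrib, Pi.sub_apply, Pi.smul_apply, smul_eq_mul]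
  exact sum_congr rfl fun _ _ => by ring

theorem scaledForm_sum_left (n : ℕ) (d : ℕ → ℚ) {ι : Type*} (s : Finset ι) (c : ι → ℚ)
    (u : ι → ℕ → ℚ) (w : ℕ → ℚ) :
    scaledForm n d (fun l => ∑ i ∈ s, c i * u i l) w = ∑ i ∈ s, c i * scaledForm n d (u i) w := by
  simp only [scaledForm, mul_sum, sum_mul, sum_div]
  rw [sum_comm]
  exact sum_congr rfl fun _ _ => sum_congr rfl fun _ _ => by ring

/-- The inner product of the lattice vectors `(u, √Γ u·x)` and `(v, √Γ v·x)`, where the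
coordinates of `u` and `v` are stored at the positions `n + 1, …, 2n`. -/
def latticeForm (n : ℕ) (x : ℕ → ℚ) (Γ : ℚ) (u v : ℕ → ℚ) : ℚ :=
  ∑ t ∈ range n, u (n + 1 + t) * v (n + 1 + t) +
    Γ * (∑ t ∈ range n, u (n + 1 + t) * x t) * ∑ t ∈ range n, v (n + 1 + t) * x t

theorem latticeForm_comm (n : ℕ) (x : ℕ → ℚ) (Γ : ℚ) (u v : ℕ → ℚ) :
    latticeForm n x Γ u v = latticeForm n x Γ v u := by
  simp only [latticeForm, mul_comm (u _) (v _)]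
  ring

theorem latticeForm_sub_smul_left (n : ℕ) (x : ℕ → ℚ) (Γ : ℚ) (u v w : ℕ → ℚ) (q : ℚ) :
    latticeForm n x Γ (u - q • v) w = latticeForm n x Γ u w - q * latticeForm n x Γ v w := by
  simp only [latticeForm, Pi.sub_apply, Pi.smul_apply, smul_eq_mul, sub_mul, sum_sub_distrib,
    mul_assoc, ← mul_sum]
  ring

theorem latticeForm_sum_left (n : ℕ) (x : ℕ → ℚ) (Γ : ℚ) {ι : Type*} (s : Finset ι) (c : ι → ℚ)
    (u : ι → ℕ → ℚ) (w : ℕ → ℚ) :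
    latticeForm n x Γ (fun l => ∑ i ∈ s, c i * u i l) w =
      ∑ i ∈ s, c i * latticeForm n x Γ (u i) w := by
  have h : ∀ y : ℕ → ℚ, ∑ t ∈ range n, (∑ i ∈ s, c i * u i (n + 1 + t)) * y t =
      ∑ i ∈ s, c i * ∑ t ∈ range n, u i (n + 1 + t) * y t := fun y => by
    simp only [mul_sum, sum_mul]
    rw [sum_comm]
    exact sum_congr rfl fun _ _ => sum_congr rfl fun _ _ => by ring
  simp only [latticeForm, h]
  generalize ∑ t ∈ range n, w (n + 1 + t) * x t = y
  rw [mul_sum, sum_mul, ← sum_add_distrib]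
  exact sum_congr rfl fun _ _ => by ring

/-- The coefficients `d_j μ_{ij}` of an integral Gram matrix are integers: they are determinants
of submatrices of the Gram matrix. -/
theorem exists_int_of_scaledForm {n : ℕ} {d : ℕ → ℚ} {L : ℕ → ℕ → ℚ} {g : ℕ → ℕ → ℤ}
    (hd0 : d 0 = 1) (hd : ∀ l ≤ n, d l ≠ 0) (hdiag : ∀ i, 1 ≤ i → i ≤ n → L i i = d i)
    (hlower : ∀ i j, i < j → j ≤ n → L i j = 0)
    (hg : ∀ i j, 1 ≤ i → i ≤ n → 1 ≤ j → j ≤ n → scaledForm n d (L i) (L j) = g i j)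
    {i j : ℕ} (hj : 1 ≤ j) (hjn : j ≤ n) (hi : 1 ≤ i) (hin : i ≤ n) : ∃ z : ℤ, L i j = z := by
  rcases lt_or_ge i j with hij | hij
  · exact ⟨0, by simp [hlower i j hij hjn]⟩
  obtain ⟨m, rfl⟩ : ∃ m, j = m + 1 := ⟨j - 1, by omega⟩
  -- the rows `1, …, m, i` and the columns `1, …, m + 1` of the Gram matrix
  let r : Fin (m + 1) → ℕ := fun a => if (a : ℕ) < m then a + 1 else i
  let N : Matrix (Fin (m + 1)) (Fin (m + 1)) ℤ := fun a b => g (r a) (b + 1)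
  let X : Matrix (Fin (m + 1)) (Fin (m + 1)) ℚ := fun a l => L (r a) (l + 1)
  let Y : Matrix (Fin (m + 1)) (Fin (m + 1)) ℚ :=
    fun l b => L (b + 1) (l + 1) / (d l * d (l + 1))
  have hr : ∀ a, 1 ≤ r a ∧ r a ≤ n := fun a => by
    simp only [r]; split_ifs <;> omega
  have hN : N.map (Int.cast : ℤ → ℚ) = X * Y := by
    ext a b
    rw [Matrix.map_apply, Matrix.mul_apply, ← hg _ _ (hr a).1 (hr a).2 (by omega) (by omega),
      scaledForm]
    simp only [X, Y]
    rw [Fin.sum_univ_eq_sum_range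
      (fun l => L (r a) (l + 1) * (L (b + 1) (l + 1) / (d l * d (l + 1)))) (m + 1)]
    rw [← sum_subset (range_subset_range.2 (by omega : m + 1 ≤ n))]
    · exact sum_congr rfl fun _ _ => by ring
    · intro l hl hl'
      rw [mem_range] at hl hl'
      rw [hlower (b + 1) (l + 1) (by omega) (by omega)]
      simp
  have hX : X.det = (∏ a ∈ range m, d (a + 1)) * L i (m + 1) := by
    rw [Matrix.det_of_isLowerTriangular, Fin.prod_univ_castSucc]
    · congr 1
      · rw [← Fin.prod_univ_eq_prod_range (fun a => d (a + 1)) m]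
        refine prod_congr rfl fun a _ => ?_
        simp only [X, r, Fin.val_castSucc, a.2, if_true]
        exact hdiag _ (by omega) (by omega)
      · simp [X, r]
    · intro a b hab
      have hab : a < b := hab
      have h1 : (a : ℕ) < b := hab
      have h2 : (a : ℕ) < m := by omega
      simp only [X, r, h2, if_true]
      exact hlower _ _ (by omega) (by omega)
  have hY : Y.det = (∏ a ∈ range m, d (a + 1))⁻¹ := by
    rw [Matrix.det_of_isUpperTriangular]
    · have : ∀ l : Fin (m + 1), Y l l = (d l)⁻¹ := fun l => by
        simp only [Y]
        rw [hdiag _ (by omega) (by omega)]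
        have h1 := hd l (by omega)
        have h2 := hd (l + 1) (by omega)
        field_simp
      simp only [this]
      rw [Fin.prod_univ_eq_prod_range (fun a => (d a)⁻¹) (m + 1), prod_range_succ', hd0]
      simp
    · intro a b hab
      have h1 : (b : ℕ) < a := hab
      simp only [Y]
      rw [hlower _ _ (by omega) (by omega)]
      simp
  have hp : ∏ a ∈ range m, d (a + 1) ≠ 0 :=
    prod_ne_zero_iff.2 fun a ha => hd _ (by rw [mem_range] at ha; omega)
  refine ⟨N.det, ?_⟩
  have := congrArg Matrix.det hN
  rw [Matrix.det_mul, hX, hY] at this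
  have h2 : (N.map (Int.cast : ℤ → ℚ)).det = (N.det : ℚ) :=
    ((Int.castRingHom ℚ).map_det N).symm
  rw [← h2, this]
  field_simp

/-- The weight `Γ` of the extra coordinate `x·u` of a lattice vector. It is so large that every
basis satisfying the Lovász conditions has only its last vector not orthogonal to `x`. -/
def weight (n : ℕ) (x : ℕ → ℤ) : ℤ := 4 ^ n * (1 + ∑ t ∈ range n, x t ^ 2)

/-- The Gram determinant of the lattice generated by the vectors `(e_i, √Γ x_i)`. -/
def volSq (n : ℕ) (x : ℕ → ℤ) : ℤ := 1 + weight n x * ∑ t ∈ range n, x t ^ 2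

/-- A row of an integer matrix, as a rational vector. -/
def castRow (u : ℕ → ℤ) : ℕ → ℚ := fun j => u j

@[simp] theorem castRow_apply (u : ℕ → ℤ) (j : ℕ) : castRow u j = u j := rfl

theorem castRow_sub_smul (u v : ℕ → ℤ) (q : ℤ) :
    castRow (u - q • v) = castRow u - (q : ℚ) • castRow v := by
  ext j; simp

/-- `W` stores a basis `b_1, …, b_n` of the lattice generated by the vectors `(e_i, √Γ x_i)`
together with its integral Gram–Schmidt data. The entry `W i j` with `1 ≤ i, j ≤ n` is
`d_j μ_{ij}`, where `d_j` is the Gram determinant of `b_1, …, b_j`; in particular `W i i = d_i`.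
Row and column `0` hold `d_0 = 1`. The columns `n + 1, …, 2n` hold the coordinates of the basis
vectors. That the vectors generate the whole lattice is recorded only through the invariant
determinant `last` and through `nondeg`: not all of them are orthogonal to `x`. -/
structure IsBasisData (n : ℕ) (x : ℕ → ℤ) (W : ℕ → ℕ → ℤ) : Prop where
  zero_zero : W 0 0 = 1
  lower : ∀ i j, i < j → j ≤ n → W i j = 0
  pos : ∀ i ≤ n, 0 < W i i
  le_vol : ∀ i ≤ n, W i i ≤ volSq n x
  last : W n n = volSq n x
  gram : ∀ i j, 1 ≤ i → i ≤ n → 1 ≤ j → j ≤ n →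
    scaledForm n (fun l => W l l) (castRow (W i)) (castRow (W j)) =
      latticeForm n (castRow x) (weight n x) (castRow (W i)) (castRow (W j))
  nondeg : ∃ i, 1 ≤ i ∧ i ≤ n ∧ ∑ t ∈ range n, W i (n + 1 + t) * x t ≠ 0
  col_zero : ∀ i, 1 ≤ i → W i 0 = 0
  row_zero : ∀ j, 1 ≤ j → W 0 j = 0
  rows : ∀ i j, n < i → W i j = 0
  cols : ∀ i j, 2 * n < j → W i j = 0

/-- The squared length of the lattice vector whose coordinates `u` holds at the positions
`n + 1, …, 2n`. -/
def normSq (n : ℕ) (x : ℕ → ℤ) (u : ℕ → ℤ) : ℤ :=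
  ∑ t ∈ range n, u (n + 1 + t) ^ 2 + weight n x * (∑ t ∈ range n, u (n + 1 + t) * x t) ^ 2

theorem cast_normSq (n : ℕ) (x : ℕ → ℤ) (u : ℕ → ℤ) :
    (normSq n x u : ℚ) = latticeForm n (castRow x) (weight n x) (castRow u) (castRow u) := by
  simp only [normSq, latticeForm, castRow]
  push_cast
  simp only [sq]
  ring

theorem weight_pos (n : ℕ) (x : ℕ → ℤ) : 0 < weight n x := by
  have : 0 ≤ ∑ t ∈ range n, x t ^ 2 := sum_nonneg fun _ _ => sq_nonneg _
  unfold weight; positivity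

theorem normSq_nonneg (n : ℕ) (x u : ℕ → ℤ) : 0 ≤ normSq n x u :=
  add_nonneg (sum_nonneg fun _ _ => sq_nonneg _) (mul_nonneg (weight_pos n x).le (sq_nonneg _))

theorem one_le_volSq (n : ℕ) (x : ℕ → ℤ) : 1 ≤ volSq n x := by
  have h1 : 0 ≤ ∑ t ∈ range n, x t ^ 2 := sum_nonneg fun _ _ => sq_nonneg _
  have h2 := weight_pos n x
  unfold volSq; nlinarith [mul_nonneg h2.le h1]

namespace IsBasisData

variable {n : ℕ} {x : ℕ → ℤ} {W : ℕ → ℕ → ℤ}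

/-- The summand of the column `j` in the Gram–Schmidt expansion of the squared length of `b_i` is at
most that squared length. -/
theorem sq_le_mul_normSq (h : IsBasisData n x W) {i j : ℕ} (hi : 1 ≤ i) (hin : i ≤ n) (hj : 1 ≤ j)
    (hjn : j ≤ n) : (W i j) ^ 2 ≤ W (j - 1) (j - 1) * W j j * normSq n x (W i) := by
  obtain ⟨m, rfl⟩ : ∃ m, j = m + 1 := ⟨j - 1, by omega⟩
  have hp : ∀ l ≤ n, (0 : ℚ) < W l l := fun l hl => by exact_mod_cast h.pos l hl
  have h1 : (W i (m + 1) : ℚ) * W i (m + 1) / (W m m * W (m + 1) (m + 1)) ≤ normSq n x (W i) := by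
    rw [cast_normSq, ← h.gram i i hi hin hi hin, scaledForm]
    refine single_le_sum (f := fun l => castRow (W i) (l + 1) * castRow (W i) (l + 1) /
      ((W l l : ℚ) * W (l + 1) (l + 1))) (fun l hl => ?_) (mem_range.2 (by omega))
    rw [mem_range] at hl
    have h1 := hp l (by omega)
    have h2 := hp (l + 1) (by omega)
    have := mul_self_nonneg (castRow (W i) (l + 1))
    positivity
  have h2 := hp m (by omega)
  have h3 := hp (m + 1) (by omega)
  rw [div_le_iff₀ (by positivity)] at h1
  have h4 : (W i (m + 1) : ℚ) ^ 2 ≤ W m m * W (m + 1) (m + 1) * normSq n x (W i) := by nlinarith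
  simpa using (by exact_mod_cast h4 : W i (m + 1) ^ 2 ≤ W m m * W (m + 1) (m + 1) * _)

/-- A bound for the entries of the data of a basis with short vectors. -/
theorem abs_le (h : IsBasisData n x W) {i : ℕ} (hi : i ≤ n)
    (hnorm : 1 ≤ i → normSq n x (W i) ≤ n * volSq n x) (hn : 1 ≤ n) (j : ℕ) :
    |W i j| ≤ n * volSq n x ^ 3 := by
  have hA := one_le_volSq n x
  have hA3 : (1 : ℤ) ≤ volSq n x ^ 3 := one_le_pow₀ hA
  have hn' : (1 : ℤ) ≤ n := by exact_mod_cast hn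
  have hM : (1 : ℤ) ≤ n * volSq n x ^ 3 := by nlinarith
  rcases Nat.eq_zero_or_pos i with rfl | hi1
  · rcases Nat.eq_zero_or_pos j with rfl | hj
    · simpa [h.zero_zero] using hM
    · rw [h.row_zero j hj]; simp; positivity
  have hN := hnorm hi1
  have hsq : ∀ z : ℤ, z ^ 2 ≤ n * volSq n x ^ 3 → |z| ≤ n * volSq n x ^ 3 := fun z hz => by
    refine le_trans ?_ hz
    rw [← sq_abs]
    rcases eq_or_ne z 0 with rfl | h0
    · simp
    · nlinarith [Int.one_le_abs h0]
  apply hsq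
  rcases Nat.eq_zero_or_pos j with rfl | hj
  · rw [h.col_zero i hi1]; simp; positivity
  rcases le_or_gt j n with hjn | hjn
  · refine (h.sq_le_mul_normSq hi1 hi hj hjn).trans ?_
    have h1 := h.le_vol j hjn
    have h2 := h.le_vol (j - 1) (by omega)
    have h3 := h.pos j hjn
    have h4 := h.pos (j - 1) (by omega)
    have h5 := normSq_nonneg n x (W i)
    calc _ ≤ volSq n x * volSq n x * (n * volSq n x) := by gcongr
      _ = _ := by ring
  rcases le_or_gt j (2 * n) with hj2 | hj2
  · obtain ⟨t, rfl⟩ : ∃ t, j = n + 1 + t := ⟨j - (n + 1), by omega⟩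
    have h1 : W i (n + 1 + t) ^ 2 ≤ ∑ t ∈ range n, W i (n + 1 + t) ^ 2 :=
      single_le_sum (f := fun t => W i (n + 1 + t) ^ 2) (fun _ _ => sq_nonneg _)
        (mem_range.2 (by omega))
    have h2 : 0 ≤ weight n x * (∑ t ∈ range n, W i (n + 1 + t) * x t) ^ 2 :=
      mul_nonneg (weight_pos n x).le (sq_nonneg _)
    have h3 : volSq n x ≤ volSq n x ^ 3 := le_self_pow₀ hA (by norm_num)
    unfold normSq at hN
    nlinarith
  · rw [h.cols i j hj2]; simp; positivity

end IsBasisData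

end LLL

namespace LLL

open Finset

theorem scaledForm_congr {n : ℕ} {d d' u u' v v' : ℕ → ℚ} (hd : ∀ l ≤ n, d l = d' l)
    (hu : ∀ l < n, u (l + 1) = u' (l + 1)) (hv : ∀ l < n, v (l + 1) = v' (l + 1)) :
    scaledForm n d u v = scaledForm n d' u' v' := by
  refine sum_congr rfl fun l hl => ?_
  rw [mem_range] at hl
  rw [hd l hl.le, hd (l + 1) hl, hu l hl, hv l hl]

theorem latticeForm_congr {n : ℕ} {x u u' v v' : ℕ → ℚ} {Γ : ℚ}
    (hu : ∀ t < n, u (n + 1 + t) = u' (n + 1 + t))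
    (hv : ∀ t < n, v (n + 1 + t) = v' (n + 1 + t)) :
    latticeForm n x Γ u v = latticeForm n x Γ u' v' := by
  have h1 : ∑ t ∈ range n, u (n + 1 + t) * v (n + 1 + t) =
      ∑ t ∈ range n, u' (n + 1 + t) * v' (n + 1 + t) :=
    sum_congr rfl fun t ht => by rw [hu t (mem_range.1 ht), hv t (mem_range.1 ht)]
  have h2 : ∑ t ∈ range n, u (n + 1 + t) * x t = ∑ t ∈ range n, u' (n + 1 + t) * x t :=
    sum_congr rfl fun t ht => by rw [hu t (mem_range.1 ht)]
  have h3 : ∑ t ∈ range n, v (n + 1 + t) * x t = ∑ t ∈ range n, v' (n + 1 + t) * x t :=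
    sum_congr rfl fun t ht => by rw [hv t (mem_range.1 ht)]
  rw [latticeForm, latticeForm, h1, h2, h3]

/-! ### Size reduction -/

/-- Subtract `q` times the row `l` from the row `k`. -/
def subRow (W : ℕ → ℕ → ℤ) (k l : ℕ) (q : ℤ) : ℕ → ℕ → ℤ :=
  Function.update W k (W k - q • W l)

theorem subRow_self (W : ℕ → ℕ → ℤ) (k l : ℕ) (q : ℤ) (j : ℕ) :
    subRow W k l q k j = W k j - q * W l j := by simp [subRow]

theorem subRow_of_ne (W : ℕ → ℕ → ℤ) {k i : ℕ} (l : ℕ) (q : ℤ) (h : i ≠ k) :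
    subRow W k l q i = W i := by simp [subRow, h]

section

variable {n : ℕ} {x : ℕ → ℤ} {W : ℕ → ℕ → ℤ}

theorem subRow_diag (h : IsBasisData n x W) {k l : ℕ} (hlk : l < k) (hk : k ≤ n) (q : ℤ) (i : ℕ) :
    subRow W k l q i i = W i i := by
  rcases eq_or_ne i k with rfl | hi
  · rw [subRow_self, h.lower l i hlk hk]; ring
  · rw [subRow_of_ne _ _ _ hi]

theorem IsBasisData.subRow (h : IsBasisData n x W) {k l : ℕ} (hl : 1 ≤ l) (hlk : l < k)
    (hk : k ≤ n) (q : ℤ) : IsBasisData n x (subRow W k l q) := by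
  have hdiag := subRow_diag h hlk hk q
  -- an entry vanishes if it vanishes in both rows
  have hz : ∀ i j, W i j = 0 → (i = k → W l j = 0) → LLL.subRow W k l q i j = 0 := by
    intro i j h1 h2
    rcases eq_or_ne i k with rfl | hi
    · rw [subRow_self, h1, h2 rfl]; ring
    · rw [subRow_of_ne _ _ _ hi, h1]
  refine ⟨by rw [hdiag, h.zero_zero], fun i j hij hj => hz i j (h.lower i j hij hj) fun hi =>
    h.lower l j (by omega) hj, fun i hi => by rw [hdiag]; exact h.pos i hi,
    fun i hi => by rw [hdiag]; exact h.le_vol i hi, by rw [hdiag, h.last], ?_, ?_,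
    fun i hi => hz i 0 (h.col_zero i hi) fun _ => h.col_zero l hl,
    fun j hj => hz 0 j (h.row_zero j hj) (by omega),
    fun i j hi => hz i j (h.rows i j hi) (by omega),
    fun i j hj => hz i j (h.cols i j hj) fun _ => h.cols l j hj⟩
  · -- both forms are bilinear
    simp only [hdiag]
    have key : ∀ i j, 1 ≤ i → i ≤ n → 1 ≤ j → j ≤ n →
        scaledForm n (fun l => W l l) (castRow (LLL.subRow W k l q i)) (castRow (W j)) =
        latticeForm n (castRow x) (weight n x) (castRow (LLL.subRow W k l q i))
          (castRow (W j)) := by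
      intro i j hi hin hj hjn
      rcases eq_or_ne i k with rfl | hik
      · simp only [LLL.subRow, Function.update_self, castRow_sub_smul, scaledForm_sub_smul_left,
          latticeForm_sub_smul_left]
        rw [h.gram i j hi hin hj hjn, h.gram l j hl (by omega) hj hjn]
      · rw [subRow_of_ne _ _ _ hik, h.gram i j hi hin hj hjn]
    intro i j hi hin hj hjn
    rcases eq_or_ne j k with rfl | hjk
    · rw [scaledForm_comm, latticeForm_comm]
      conv_lhs => rw [LLL.subRow, Function.update_self]
      conv_rhs => rw [LLL.subRow, Function.update_self]
      simp only [castRow_sub_smul, scaledForm_sub_smul_left, latticeForm_sub_smul_left]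
      simp only [scaledForm_comm n _ (castRow (W _)), latticeForm_comm n _ _ (castRow (W _))]
      have e1 := key i j hi hin hj hjn
      have e2 := key i l hi hin hl (by omega)
      simp only [LLL.subRow] at e1 e2
      rw [e1, e2]
    · rw [subRow_of_ne W l q hjk]
      exact key i j hi hin hj hjn
  · obtain ⟨i, hi, hin, hy⟩ := h.nondeg
    rcases eq_or_ne i k with rfl | hik
    · by_cases hyl : ∑ t ∈ range n, W l (n + 1 + t) * x t = 0
      · refine ⟨i, hi, hin, ?_⟩
        simp only [subRow_self, sub_mul, sum_sub_distrib, mul_assoc, ← mul_sum, hyl]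
        simpa using hy
      · exact ⟨l, hl, by omega, by rwa [subRow_of_ne _ _ _ hlk.ne]⟩
    · exact ⟨i, hi, hin, by rwa [subRow_of_ne _ _ _ hik]⟩

/-- A size-reduced basis vector is short. -/
theorem IsBasisData.normSq_le (h : IsBasisData n x W) {k : ℕ} (hk : 1 ≤ k) (hkn : k ≤ n)
    (hred : ∀ l, 1 ≤ l → l < k → 2 * |W k l| ≤ W l l) :
    normSq n x (W k) ≤ n * volSq n x := by
  have hp : ∀ l ≤ n, (1 : ℚ) ≤ W l l := fun l hl => by exact_mod_cast h.pos l hl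
  have hA : ∀ l ≤ n, (W l l : ℚ) ≤ volSq n x := fun l hl => by exact_mod_cast h.le_vol l hl
  have : (normSq n x (W k) : ℚ) ≤ ∑ l ∈ range n, (volSq n x : ℚ) := by
    rw [cast_normSq, ← h.gram k k hk hkn hk hkn, scaledForm]
    refine sum_le_sum fun l hl => ?_
    rw [mem_range] at hl
    have h1 := hp l hl.le
    have h2 := hp (l + 1) hl
    have h3 : (W k (l + 1) : ℚ) ^ 2 ≤ (W (l + 1) (l + 1)) ^ 2 := by
      have : |W k (l + 1)| ≤ |W (l + 1) (l + 1)| := by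
        rw [abs_of_pos (h.pos _ hl)]
        have h0 := h.pos _ hl
        rcases lt_trichotomy (l + 1) k with hlk | rfl | hlk
        · linarith [hred _ (by omega) hlk, abs_nonneg (W k (l + 1))]
        · rw [abs_of_pos h0]
        · rw [h.lower k _ hlk hl]; simpa using h0.le
      exact_mod_cast sq_le_sq.2 this
    rw [div_le_iff₀ (by positivity)]
    simp only [castRow]
    have h4 : (W (l + 1) (l + 1) : ℚ) ^ 2 ≤ volSq n x * W (l + 1) (l + 1) := by
      rw [sq]; exact mul_le_mul_of_nonneg_right (hA _ hl) (by linarith)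
    have h5 : (volSq n x : ℚ) * W (l + 1) (l + 1) * 1 ≤
        volSq n x * W (l + 1) (l + 1) * W l l :=
      mul_le_mul_of_nonneg_left h1 (by
        have := hA _ hl
        have : (0 : ℚ) ≤ volSq n x := by linarith
        positivity)
    linarith
  rw [sum_const, card_range, nsmul_eq_mul] at this
  exact_mod_cast this

end

/-- Rounding to the nearest integer. -/
theorem abs_sub_round_mul_le (a : ℤ) {b : ℤ} (hb : 0 < b) :
    2 * |a - (2 * a + b) / (2 * b) * b| ≤ b := by
  have h1 := Int.mul_ediv_add_emod (2 * a + b) (2 * b)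
  have h2 := Int.emod_nonneg (2 * a + b) (by omega : 2 * b ≠ 0)
  have h3 := Int.emod_lt_of_pos (2 * a + b) (by omega : 0 < 2 * b)
  generalize (2 * a + b) / (2 * b) = q at *
  rcases abs_cases (a - q * b) with ⟨h, _⟩ | ⟨h, _⟩ <;> rw [h] <;> nlinarith

theorem abs_round_le (a : ℤ) {b : ℤ} (hb : 0 < b) : |(2 * a + b) / (2 * b)| ≤ |a| + 1 := by
  have h1 := Int.mul_ediv_add_emod (2 * a + b) (2 * b)
  have h2 := Int.emod_nonneg (2 * a + b) (by omega : 2 * b ≠ 0)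
  have h3 := Int.emod_lt_of_pos (2 * a + b) (by omega : 0 < 2 * b)
  generalize (2 * a + b) / (2 * b) = q at *
  have h4 := abs_nonneg a
  have h5 := neg_abs_le a
  have h6 := le_abs_self a
  rw [abs_le]
  constructor <;> by_contra hc <;> push Not at hc
  · nlinarith
  · nlinarith

/-! ### The exchange of two neighbouring basis vectors -/

/-- Exchange the rows `m + 1` and `m + 2`. -/
def swapRows (W : ℕ → ℕ → ℤ) (m : ℕ) : ℕ → ℕ → ℤ := fun i j =>
  if i = m + 1 then W (m + 2) j else if i = m + 2 then W (m + 1) j else W i j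

/-- The Gram–Schmidt data after the exchange of the basis vectors `m + 1` and `m + 2`: the rows
are exchanged, and the columns `m + 1` and `m + 2` are transformed so that the matrix becomes
lower triangular again. The divisions are exact. -/
def swapStep (W : ℕ → ℕ → ℤ) (m : ℕ) : ℕ → ℕ → ℤ := fun i j =>
  if j = m + 1 then
    (W m m * swapRows W m i (m + 2) + W (m + 2) (m + 1) * swapRows W m i (m + 1)) /
      W (m + 1) (m + 1)
  else if j = m + 2 then
    (W (m + 2) (m + 2) * swapRows W m i (m + 1) - W (m + 2) (m + 1) * swapRows W m i (m + 2)) /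
      W (m + 1) (m + 1)
  else swapRows W m i j

/-- `swapStep` with divisions in `ℚ`. -/
def swapStepRat (W : ℕ → ℕ → ℤ) (m : ℕ) : ℕ → ℕ → ℚ := fun i j =>
  if j = m + 1 then
    (W m m * swapRows W m i (m + 2) + W (m + 2) (m + 1) * swapRows W m i (m + 1)) /
      W (m + 1) (m + 1)
  else if j = m + 2 then
    (W (m + 2) (m + 2) * swapRows W m i (m + 1) - W (m + 2) (m + 1) * swapRows W m i (m + 2)) /
      W (m + 1) (m + 1)
  else swapRows W m i j

theorem swapStep_eq_of_swapStepRat {W : ℕ → ℕ → ℤ} {m i j : ℕ} (h0 : W (m + 1) (m + 1) ≠ 0)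
    (h : ∃ z : ℤ, swapStepRat W m i j = z) : (swapStep W m i j : ℚ) = swapStepRat W m i j := by
  have h0' : (W (m + 1) (m + 1) : ℚ) ≠ 0 := by exact_mod_cast h0
  have key : ∀ a z : ℤ, (a : ℚ) / W (m + 1) (m + 1) = z →
      ((a / W (m + 1) (m + 1) : ℤ) : ℚ) = z := by
    intro a z hz
    rw [div_eq_iff h0'] at hz
    have : a = z * W (m + 1) (m + 1) := by exact_mod_cast hz
    rw [this, Int.mul_ediv_cancel _ h0]
  obtain ⟨z, hz⟩ := h
  rw [hz]
  simp only [swapStep, swapStepRat] at hz ⊢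
  split_ifs at hz ⊢
  · exact key _ _ (by push_cast; exact hz)
  · exact key _ _ (by push_cast; exact hz)
  · exact hz

theorem sum_range_eq_of_pair {n m : ℕ} (hm : m + 1 < n) {f g : ℕ → ℚ}
    (h : ∀ l, l ≠ m → l ≠ m + 1 → f l = g l) (h2 : f m + f (m + 1) = g m + g (m + 1)) :
    ∑ l ∈ range n, f l = ∑ l ∈ range n, g l := by
  have hs : ({m, m + 1} : Finset ℕ) ⊆ range n := by
    intro l hl
    simp only [mem_insert, mem_singleton] at hl
    rw [mem_range]; omega
  rw [← sum_sdiff hs, ← sum_sdiff hs, sum_pair (by omega), sum_pair (by omega), h2]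
  congr 1
  refine sum_congr rfl fun l hl => ?_
  simp only [mem_sdiff, mem_insert, mem_singleton, not_or] at hl
  exact h l hl.2.1 hl.2.2

section

variable {n : ℕ} {x : ℕ → ℤ} {W : ℕ → ℕ → ℤ} {m : ℕ}

theorem swapStepRat_diag (h : IsBasisData n x W) (hm : m + 2 ≤ n) {i : ℕ} (hi : i ≠ m + 1) :
    swapStepRat W m i i = W i i := by
  have h0 : (W (m + 1) (m + 1) : ℚ) ≠ 0 := by exact_mod_cast (h.pos (m + 1) (by omega)).ne'
  rcases eq_or_ne i (m + 2) with rfl | hi2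
  · simp [swapStepRat, swapRows, h.lower (m + 1) (m + 2) (by omega) hm, h0]
  · simp [swapStepRat, swapRows, hi, hi2]

theorem swapStepRat_diag_self :
    swapStepRat W m (m + 1) (m + 1) =
      (W m m * W (m + 2) (m + 2) + W (m + 2) (m + 1) ^ 2) / W (m + 1) (m + 1) := by
  simp [swapStepRat, swapRows, sq]

theorem swapStepRat_lower (h : IsBasisData n x W) (hm : m + 2 ≤ n) {i j : ℕ} (hij : i < j)
    (hj : j ≤ n) : swapStepRat W m i j = 0 := by
  have hl : ∀ a b, a < b → b ≤ n → (W a b : ℚ) = 0 := fun a b hab hb => by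
    exact_mod_cast h.lower a b hab hb
  simp only [swapStepRat, swapRows]
  split_ifs with h1 h2 h3 h4 h5 h6 h7 h8
  · omega
  · omega
  · rw [hl i (m + 2) (by omega) (by omega), hl i (m + 1) (by omega) (by omega)]; simp
  · ring
  · omega
  · rw [hl i (m + 2) (by omega) (by omega), hl i (m + 1) (by omega) (by omega)]; simp
  · exact hl _ _ (by omega) hj
  · exact hl _ _ (by omega) hj
  · exact hl _ _ hij hj

/-- The column transformation keeps the inner products of the rows. -/
theorem scaledForm_swapStepRat (h : IsBasisData n x W) (hm : m + 2 ≤ n)  (i j : ℕ) :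
    scaledForm n (fun l => swapStepRat W m l l) (swapStepRat W m i) (swapStepRat W m j) =
      scaledForm n (fun l => W l l) (castRow (swapRows W m i)) (castRow (swapRows W m j)) := by
  have hp : ∀ l ≤ n, (0 : ℚ) < W l l := fun l hl => by exact_mod_cast h.pos l hl
  refine sum_range_eq_of_pair (m := m) (by omega) (fun l h1 h2 => ?_) ?_
  · have e : ∀ i, swapStepRat W m i (l + 1) = castRow (swapRows W m i) (l + 1) := fun i => by
      simp [swapStepRat, h1, h2]
    beta_reduce
    rw [swapStepRat_diag h hm h2, swapStepRat_diag h hm (i := l + 1) (by omega)]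
    simp only [e]
  · have h0 := hp m (by omega)
    have h1 := hp (m + 1) (by omega)
    have h2 := hp (m + 2) hm
    have e1 : ∀ i, swapStepRat W m i (m + 1) = (W m m * (swapRows W m i (m + 2) : ℚ) +
        W (m + 2) (m + 1) * swapRows W m i (m + 1)) / W (m + 1) (m + 1) := fun i => by
      simp [swapStepRat]
    have e2 : ∀ i, swapStepRat W m i (m + 1 + 1) =
        (W (m + 2) (m + 2) * (swapRows W m i (m + 1) : ℚ) -
        W (m + 2) (m + 1) * swapRows W m i (m + 2)) / W (m + 1) (m + 1) := fun i => by
      simp [swapStepRat]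
    simp only [swapStepRat_diag_self]
    rw [e1 i, e1 j, e2 i, e2 j, swapStepRat_diag h hm (by omega : m ≠ m + 1),
      swapStepRat_diag h hm (by omega : m + 1 + 1 ≠ m + 1)]
    simp only [castRow, show m + 1 + 1 = m + 2 from rfl]
    have h3 : 0 < (W m m : ℚ) * W (m + 2) (m + 2) + (W (m + 2) (m + 1) : ℚ) ^ 2 := by positivity
    generalize (W m m : ℚ) = a at *
    generalize (W (m + 1) (m + 1) : ℚ) = b at *
    generalize (W (m + 2) (m + 2) : ℚ) = c at *
    generalize (W (m + 2) (m + 1) : ℚ) = r at *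
    field_simp
    ring

theorem swapRows_eq (i : ℕ) : swapRows W m i = W (Equiv.swap (m + 1) (m + 2) i) := by
  ext j
  simp only [swapRows, Equiv.swap_apply_def]
  split_ifs <;> rfl

theorem swap_mem_Icc (hm : m + 2 ≤ n) {i : ℕ} (hi : 1 ≤ i) (hin : i ≤ n) :
    1 ≤ Equiv.swap (m + 1) (m + 2) i ∧ Equiv.swap (m + 1) (m + 2) i ≤ n := by
  rw [Equiv.swap_apply_def]
  split_ifs <;> omega

theorem swapStep_coord (hm : m + 2 ≤ n) (i t : ℕ) :
    swapStep W m i (n + 1 + t) = W (Equiv.swap (m + 1) (m + 2) i) (n + 1 + t) := by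
  rw [← swapRows_eq (W := W)]
  simp only [swapStep]
  rw [if_neg (by omega), if_neg (by omega)]

/-- The divisions in the exchange step are exact. -/
theorem cast_swapStep (h : IsBasisData n x W) (hm : m + 2 ≤ n) {i j : ℕ} (hi : i ≤ n)
    (hj : j ≤ n) : (swapStep W m i j : ℚ) = swapStepRat W m i j := by
  have hp : ∀ l ≤ n, (0 : ℚ) < W l l := fun l hl => by exact_mod_cast h.pos l hl
  refine swapStep_eq_of_swapStepRat (h.pos _ (by omega)).ne' ?_
  rcases lt_or_ge i j with hij | hij
  · exact ⟨0, by simp [swapStepRat_lower h hm hij hj]⟩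
  rcases Nat.eq_zero_or_pos j with rfl | hj1
  · exact ⟨swapRows W m i 0, by simp [swapStepRat]⟩
  refine exists_int_of_scaledForm (n := n) (d := fun l => swapStepRat W m l l)
    (L := swapStepRat W m) (g := fun a b => ∑ t ∈ range n,
      swapRows W m a (n + 1 + t) * swapRows W m b (n + 1 + t) +
      weight n x * (∑ t ∈ range n, swapRows W m a (n + 1 + t) * x t) *
        ∑ t ∈ range n, swapRows W m b (n + 1 + t) * x t) ?_ ?_ (fun _ _ _ => rfl)
    (fun a b hab hb => swapStepRat_lower h hm hab hb) ?_ hj1 hj (by omega) hi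
  · rw [swapStepRat_diag h hm (by omega), h.zero_zero]; simp
  · intro l hl
    rcases eq_or_ne l (m + 1) with rfl | hlm
    · simp only [swapStepRat_diag_self]
      have h0 := hp m (by omega)
      have h1 := hp (m + 1) (by omega)
      have h2 := hp (m + 2) hm
      positivity
    · simp only [swapStepRat_diag h hm hlm]
      exact (hp l hl).ne'
  · intro a b ha han hb hbn
    have ha' := swap_mem_Icc hm ha han
    have hb' := swap_mem_Icc hm hb hbn
    rw [scaledForm_swapStepRat h hm, swapRows_eq, swapRows_eq, h.gram _ _ ha'.1 ha'.2 hb'.1 hb'.2]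
    simp [latticeForm]

theorem swapStep_diag (h : IsBasisData n x W) (hm : m + 2 ≤ n) {i : ℕ} (hin : i ≤ n)
    (hi : i ≠ m + 1) : swapStep W m i i = W i i := by
  have := cast_swapStep h hm hin hin
  rw [swapStepRat_diag h hm hi] at this
  exact_mod_cast this

theorem swapStep_diag_self (h : IsBasisData n x W) (hm : m + 2 ≤ n) :
    swapStep W m (m + 1) (m + 1) * W (m + 1) (m + 1) =
      W m m * W (m + 2) (m + 2) + W (m + 2) (m + 1) ^ 2 := by
  have h1 := cast_swapStep h hm (i := m + 1) (j := m + 1) (by omega) (by omega)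
  have h0 : (W (m + 1) (m + 1) : ℚ) ≠ 0 := by exact_mod_cast (h.pos (m + 1) (by omega)).ne'
  rw [swapStepRat_diag_self, eq_div_iff h0] at h1
  exact_mod_cast h1

/-- If the Lovász condition fails, the exchange shrinks the Gram determinant `d_{m+1}`. -/
theorem swapStep_diag_lt (h : IsBasisData n x W) (hm : m + 2 ≤ n)
    (hlov : 4 * (W m m * W (m + 2) (m + 2) + W (m + 2) (m + 1) ^ 2) < 3 * W (m + 1) (m + 1) ^ 2) :
    4 * swapStep W m (m + 1) (m + 1) < 3 * W (m + 1) (m + 1) := by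
  have h1 := swapStep_diag_self h hm
  have h0 := h.pos (m + 1) (by omega)
  nlinarith

theorem IsBasisData.swapStep (h : IsBasisData n x W) (hm : m + 2 ≤ n)
    (hlov : 4 * (W m m * W (m + 2) (m + 2) + W (m + 2) (m + 1) ^ 2) < 3 * W (m + 1) (m + 1) ^ 2) :
    IsBasisData n x (swapStep W m) := by
  have hpos : ∀ i ≤ n, 0 < LLL.swapStep W m i i := by
    intro i hi
    rcases eq_or_ne i (m + 1) with rfl | him
    · have h1 := swapStep_diag_self h hm
      have h0 := h.pos (m + 1) hi
      have h2 := h.pos m (by omega)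
      have h3 := h.pos (m + 2) hm
      have : 0 < LLL.swapStep W m (m + 1) (m + 1) * W (m + 1) (m + 1) := by rw [h1]; positivity
      exact pos_of_mul_pos_left this h0.le
    · rw [swapStep_diag h hm hi him]; exact h.pos i hi
  refine ⟨by rw [swapStep_diag h hm (by omega) (by omega), h.zero_zero], ?_, hpos, ?_,
    by rw [swapStep_diag h hm le_rfl (by omega), h.last], ?_, ?_, ?_, ?_, ?_, ?_⟩
  · intro i j hij hj
    have := cast_swapStep h hm (i := i) (j := j) (by omega) hj
    rw [swapStepRat_lower h hm hij hj] at this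
    exact_mod_cast this
  · intro i hi
    rcases eq_or_ne i (m + 1) with rfl | him
    · linarith [swapStep_diag_lt h hm hlov, h.le_vol (m + 1) hi, hpos _ hi, h.pos _ hi]
    · rw [swapStep_diag h hm hi him]; exact h.le_vol i hi
  · intro i j hi hin hj hjn
    have hi' := swap_mem_Icc hm hi hin
    have hj' := swap_mem_Icc hm hj hjn
    rw [scaledForm_congr (d' := fun l => swapStepRat W m l l) (u' := swapStepRat W m i)
      (v' := swapStepRat W m j) (fun l hl => cast_swapStep h hm hl hl)
      (fun l hl => cast_swapStep h hm hin hl) (fun l hl => cast_swapStep h hm hjn hl),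
      scaledForm_swapStepRat h hm, swapRows_eq, swapRows_eq,
      h.gram _ _ hi'.1 hi'.2 hj'.1 hj'.2]
    refine latticeForm_congr (fun t _ => ?_) (fun t _ => ?_) <;>
      simp only [castRow, swapStep_coord hm]
  · obtain ⟨i, hi, hin, hy⟩ := h.nondeg
    have hi' := swap_mem_Icc hm hi hin
    refine ⟨_, hi'.1, hi'.2, ?_⟩
    simpa only [swapStep_coord hm, Equiv.swap_apply_self] using hy
  · intro i hi
    have : LLL.swapStep W m i 0 = swapRows W m i 0 := by simp [LLL.swapStep]
    rw [this, swapRows_eq]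
    refine h.col_zero _ ?_
    rw [Equiv.swap_apply_def]
    split_ifs <;> omega
  · intro j hj
    have : ∀ j, 1 ≤ j → swapRows W m 0 j = 0 := fun j hj => by
      simp [swapRows, h.row_zero j hj]
    simp only [LLL.swapStep]
    split_ifs <;> simp [this _ hj, this (m + 1) (by omega), this (m + 2) (by omega)]
  · intro i j hi
    have : ∀ j, swapRows W m i j = 0 := fun j => by
      simp only [swapRows]
      rw [if_neg (by omega), if_neg (by omega), h.rows i j hi]
    simp only [LLL.swapStep]
    split_ifs <;> simp [this]
  · intro i j hj
    simp only [LLL.swapStep]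
    rw [if_neg (by omega), if_neg (by omega), swapRows_eq, h.cols _ _ hj]

theorem normSq_swapStep (hm : m + 2 ≤ n) (i : ℕ) :
    normSq n x (swapStep W m i) = normSq n x (W (Equiv.swap (m + 1) (m + 2) i)) := by
  simp only [normSq, swapStep_coord hm]

end

end LLL

namespace LLL

open Finset

/-! ### The potential -/

/-- The product of the Gram determinants `d_1, …, d_n`. -/
def potential (n : ℕ) (W : ℕ → ℕ → ℤ) : ℕ := ∏ l ∈ range n, (W (l + 1) (l + 1)).natAbs

/-- The binary logarithm of the cube of the potential. Since `(3 / 4) ^ 3 < 1 / 2`, it drops in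
each exchange. -/
def level (n : ℕ) (W : ℕ → ℕ → ℤ) : ℕ := Nat.log 2 (potential n W ^ 3)

section

variable {n : ℕ} {x : ℕ → ℤ} {W : ℕ → ℕ → ℤ} {m : ℕ}

theorem level_congr {W' : ℕ → ℕ → ℤ} (h : ∀ i, W' i i = W i i) : level n W' = level n W := by
  simp only [level, potential, h]

theorem potential_pos (h : IsBasisData n x W) : 0 < potential n W :=
  prod_pos fun l hl => Int.natAbs_pos.2 (h.pos _ (by rw [mem_range] at hl; omega)).ne'

theorem level_swapStep_lt (h : IsBasisData n x W) (hm : m + 2 ≤ n)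
    (hlov : 4 * (W m m * W (m + 2) (m + 2) + W (m + 2) (m + 1) ^ 2) < 3 * W (m + 1) (m + 1) ^ 2) :
    level n (swapStep W m) < level n W := by
  have h' := h.swapStep hm hlov
  have hmem : m ∈ range n := mem_range.2 (by omega)
  have hlt : 4 * potential n (swapStep W m) < 3 * potential n W := by
    simp only [potential]
    rw [← mul_prod_erase _ _ hmem,
      ← mul_prod_erase _ (fun l => (W (l + 1) (l + 1)).natAbs) hmem]
    have e : ∏ l ∈ (range n).erase m, (swapStep W m (l + 1) (l + 1)).natAbs =
        ∏ l ∈ (range n).erase m, (W (l + 1) (l + 1)).natAbs := by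
      refine prod_congr rfl fun l hl => ?_
      rw [mem_erase, mem_range] at hl
      rw [swapStep_diag h hm hl.2 (by omega)]
    have hp : 0 < ∏ l ∈ (range n).erase m, (W (l + 1) (l + 1)).natAbs :=
      prod_pos fun l hl => by
        rw [mem_erase, mem_range] at hl
        exact Int.natAbs_pos.2 (h.pos _ hl.2).ne'
    rw [e, ← mul_assoc, ← mul_assoc]
    refine Nat.mul_lt_mul_of_pos_right ?_ hp
    have h1 := swapStep_diag_lt h hm hlov
    have h2 := h'.pos (m + 1) (by omega)
    have h3 := h.pos (m + 1) (by omega)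
    omega
  have hpos := potential_pos h'
  unfold level
  generalize potential n (swapStep W m) = a at *
  generalize potential n W = b at *
  have h2 : 2 * a ^ 3 ≤ b ^ 3 := by
    have : (4 * a) ^ 3 < (3 * b) ^ 3 := Nat.pow_lt_pow_left hlt (by norm_num)
    rw [mul_pow, mul_pow] at this
    omega
  calc Nat.log 2 (a ^ 3) < Nat.log 2 (a ^ 3) + 1 := Nat.lt_succ_self _
    _ = Nat.log 2 (a ^ 3 * 2) := (Nat.log_mul_base (by norm_num) (by positivity)).symm
    _ ≤ _ := Nat.log_mono_right (by omega)

theorem level_le (h : IsBasisData n x W) {c : ℕ} (hc : volSq n x ≤ 2 ^ c) :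
    level n W ≤ 3 * n * c := by
  have h1 : potential n W ≤ (2 ^ c) ^ n := by
    calc potential n W ≤ ∏ _l ∈ range n, 2 ^ c := prod_le_prod' fun l hl => by
          rw [mem_range] at hl
          have h2 := (h.le_vol (l + 1) hl).trans hc
          have h3 := h.pos (l + 1) hl
          zify
          rwa [abs_of_pos h3]
      _ = _ := by simp
  calc level n W ≤ Nat.log 2 (2 ^ (3 * n * c)) := Nat.log_mono_right (by
        calc potential n W ^ 3 ≤ ((2 ^ c) ^ n) ^ 3 := Nat.pow_le_pow_left h1 3
          _ = _ := by rw [← pow_mul, ← pow_mul]; congr 1; ring)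
    _ = _ := Nat.log_pow (by norm_num) _

/-! ### The first vector of a reduced basis -/

/-- Solving a triangular system: a combination of the `j`-th row with earlier rows which
vanishes in the columns `1, …, j - 1`. -/
theorem exists_comb (h : IsBasisData n x W) {j : ℕ} (hj : 1 ≤ j) (hjn : j ≤ n) :
    ∃ v : ℕ → ℚ, v j = 1 ∧ (∀ i, j < i → v i = 0) ∧
      ∀ c, 1 ≤ c → c < j → ∑ i ∈ Icc 1 n, v i * W i c = 0 := by
  suffices H : ∀ s < j, ∃ v : ℕ → ℚ, v j = 1 ∧ (∀ i, j < i → v i = 0) ∧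
      ∀ c, j - s ≤ c → c < j → ∑ i ∈ Icc 1 n, v i * W i c = 0 by
    obtain ⟨v, h1, h2, h3⟩ := H (j - 1) (by omega)
    exact ⟨v, h1, h2, fun c hc => h3 c (by omega)⟩
  intro s
  induction s with
  | zero =>
    exact fun _ => ⟨Pi.single j 1, by simp, fun i hi => by simp [hi.ne'],
      fun c h1 h2 => by omega⟩
  | succ s ih =>
    intro hs
    obtain ⟨v, h1, h2, h3⟩ := ih (by omega)
    obtain ⟨c, hc⟩ : ∃ c, c = j - (s + 1) := ⟨_, rfl⟩
    have hWc : (W c c : ℚ) ≠ 0 := by exact_mod_cast (h.pos c (by omega)).ne'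
    obtain ⟨a, ha⟩ : ∃ a, a = -(∑ i ∈ Icc 1 n, v i * W i c) / W c c := ⟨_, rfl⟩
    refine ⟨v + Pi.single c a, ?_, fun i hi => ?_, fun b hb hbj => ?_⟩
    · simp [h1, show j ≠ c by omega]
    · simp [h2 i hi, show i ≠ c by omega]
    · have : ∑ i ∈ Icc 1 n, (v + Pi.single c a : ℕ → ℚ) i * W i b =
          ∑ i ∈ Icc 1 n, v i * W i b + a * W c b := by
        simp only [Pi.add_apply, add_mul, sum_add_distrib]
        congr 1
        rw [sum_eq_single c]
        · simp
        · intro i _ hi; simp [hi]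
        · intro hc'; rw [mem_Icc] at hc'; omega
      rw [this]
      rcases eq_or_ne b c with rfl | hbc
      · rw [ha]; field_simp; ring
      · rw [h3 b (by omega) hbj, h.lower c b (by omega) (by omega)]; simp

/-- The orthogonal component of the `j`-th basis vector has squared length `d_j / d_{j-1}`. If the
earlier vectors are orthogonal to `x`, it has the same product with `x` as the `j`-th vector. -/
theorem exists_orthogonal_component (h : IsBasisData n x W) {j : ℕ} (hjn : j + 1 ≤ n)
    (hy : ∀ i, 1 ≤ i → i < j + 1 → ∑ t ∈ range n, W i (n + 1 + t) * x t = 0) :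
    ∃ u : ℕ → ℚ, latticeForm n (castRow x) (weight n x) u u = W (j + 1) (j + 1) / W j j ∧
      ∑ t ∈ range n, u (n + 1 + t) * x t = (∑ t ∈ range n, W (j + 1) (n + 1 + t) * x t : ℤ) := by
  obtain ⟨v, h1, h2, h3⟩ := exists_comb h (show 1 ≤ j + 1 by omega) hjn
  have hp : ∀ l ≤ n, (0 : ℚ) < W l l := fun l hl => by exact_mod_cast h.pos l hl
  let u : ℕ → ℚ := fun l => ∑ i ∈ Icc 1 n, v i * castRow (W i) l
  have hform : latticeForm n (castRow x) (weight n x) u u =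
      scaledForm n (fun l => W l l) u u := by
    simp only [u]
    rw [latticeForm_sum_left, scaledForm_sum_left]
    refine sum_congr rfl fun i hi => ?_
    rw [mem_Icc] at hi
    rw [latticeForm_comm, scaledForm_comm, latticeForm_sum_left, scaledForm_sum_left]
    congr 1
    refine sum_congr rfl fun k hk => ?_
    rw [mem_Icc] at hk
    rw [h.gram k i hk.1 hk.2 hi.1 hi.2]
  have hu : ∀ l < n, l ≠ j → u (l + 1) = 0 := by
    intro l hl hlj
    rcases lt_or_gt_of_ne hlj with hlt | hgt
    · exact h3 (l + 1) (by omega) (by omega)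
    · refine sum_eq_zero fun i _ => ?_
      rcases lt_or_ge (j + 1) i with hi | hi
      · rw [h2 i hi, zero_mul]
      · simp [castRow, h.lower i (l + 1) (by omega) (by omega)]
  have huj : u (j + 1) = W (j + 1) (j + 1) := by
    simp only [u]
    rw [sum_eq_single (j + 1)]
    · simp [h1]
    · intro i _ hi
      rcases lt_or_gt_of_ne hi with hlt | hgt
      · simp [castRow, h.lower i (j + 1) hlt hjn]
      · rw [h2 i hgt, zero_mul]
    · intro hc; rw [mem_Icc] at hc; omega
  refine ⟨u, ?_, ?_⟩
  · rw [hform, scaledForm, sum_eq_single j]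
    · rw [huj]
      have h4 := hp j (by omega)
      have h5 := hp (j + 1) hjn
      field_simp
    · intro l hl hlj
      rw [hu l (mem_range.1 hl) hlj]; simp
    · intro hc; rw [mem_range] at hc; omega
  · simp only [u, sum_mul]
    rw [sum_comm, sum_eq_single (j + 1)]
    · simp [h1]
    · intro i hi hij
      rw [mem_Icc] at hi
      rcases lt_or_gt_of_ne hij with hlt | hgt
      · have := hy i hi.1 hlt
        simp only [mul_assoc, ← mul_sum]
        have h' : ∑ t ∈ range n, castRow (W i) (n + 1 + t) * (x t : ℚ) = 0 := by
          simp only [castRow]; exact_mod_cast this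
        rw [h', mul_zero]
      · simp [h2 i hgt]
    · intro hc; rw [mem_Icc] at hc; omega

/-- The extra coordinate alone bounds the length of the orthogonal component of the vector
`j + 1` from below. -/
theorem weight_mul_le (h : IsBasisData n x W) {j : ℕ} (hjn : j + 1 ≤ n)
    (hy : ∀ i, 1 ≤ i → i < j + 1 → ∑ t ∈ range n, W i (n + 1 + t) * x t = 0) :
    weight n x * (∑ t ∈ range n, W (j + 1) (n + 1 + t) * x t) ^ 2 * W j j ≤ W (j + 1) (j + 1) := by
  obtain ⟨u, hu, hux⟩ := exists_orthogonal_component h hjn hy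
  have hp : (0 : ℚ) < W j j := by exact_mod_cast h.pos j (by omega)
  simp only [latticeForm, castRow] at hu
  rw [hux, eq_div_iff hp.ne'] at hu
  have h1 : 0 ≤ ∑ t ∈ range n, u (n + 1 + t) * u (n + 1 + t) :=
    sum_nonneg fun t _ => mul_self_nonneg _
  have : (weight n x * (∑ t ∈ range n, W (j + 1) (n + 1 + t) * x t : ℤ) ^ 2 * W j j : ℚ) ≤
      W (j + 1) (j + 1) := by
    nlinarith [mul_nonneg h1 hp.le]
  exact_mod_cast this

/-- A sharper lower bound for the length of the orthogonal component, by the Cauchy–Schwarz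
inequality. -/
theorem volSq_mul_le (h : IsBasisData n x W) {j : ℕ} (hjn : j + 1 ≤ n)
    (hy : ∀ i, 1 ≤ i → i < j + 1 → ∑ t ∈ range n, W i (n + 1 + t) * x t = 0) :
    (∑ t ∈ range n, W (j + 1) (n + 1 + t) * x t) ^ 2 * volSq n x * W j j ≤
      W (j + 1) (j + 1) * ∑ t ∈ range n, x t ^ 2 := by
  obtain ⟨u, hu, hux⟩ := exists_orthogonal_component h hjn hy
  have hp : (0 : ℚ) < W j j := by exact_mod_cast h.pos j (by omega)
  have hcs := sum_mul_sq_le_sq_mul_sq (range n) (fun t => u (n + 1 + t)) (fun t => (x t : ℚ))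
  simp only [latticeForm, castRow] at hu
  rw [hux] at hcs
  rw [hux, eq_div_iff hp.ne'] at hu
  simp only [← sq] at hu
  generalize (∑ t ∈ range n, W (j + 1) (n + 1 + t) * x t : ℤ) = y at *
  have : (y : ℚ) ^ 2 * volSq n x * W j j ≤ W (j + 1) (j + 1) * ∑ t ∈ range n, (x t : ℚ) ^ 2 := by
    rw [volSq]
    push_cast
    rw [← hu]
    nlinarith [mul_le_mul_of_nonneg_right hcs hp.le]
  exact_mod_cast this

/-- In a basis satisfying the Lovász conditions all vectors except the last are orthogonal to `x`:
the first vector that is not has an orthogonal component of squared length at least `Γ`, and the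
later components are not much shorter, which would make the volume too large. -/
theorem orthogonal_of_reduced (h : IsBasisData n x W)
    (hlov : ∀ m, m + 2 ≤ n → W (m + 1) (m + 1) ^ 2 ≤ 2 * (W m m * W (m + 2) (m + 2)))
    {j : ℕ} (hj : 1 ≤ j) (hjn : j < n) : ∑ t ∈ range n, W j (n + 1 + t) * x t = 0 := by
  induction j using Nat.strong_induction_on with
  | _ j ih =>
  by_contra hne
  obtain ⟨m, rfl⟩ : ∃ m, j = m + 1 := ⟨j - 1, by omega⟩
  have hw := weight_mul_le h hjn.le fun i hi hij => ih i hij hi (by omega)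
  have hy : (1 : ℤ) ≤ (∑ t ∈ range n, W (m + 1) (n + 1 + t) * x t) ^ 2 := by
    have := sq_pos_of_ne_zero hne; omega
  have hΓ := weight_pos n x
  have hm0 := h.pos m (by omega)
  have h0 : weight n x * W m m ≤ W (m + 1) (m + 1) := by nlinarith [mul_pos hΓ hm0]
  -- the later orthogonal components
  have hstep : ∀ s, m + s + 1 ≤ n →
      weight n x * W (m + s) (m + s) ≤ 2 ^ s * W (m + s + 1) (m + s + 1) := by
    intro s
    induction s with
    | zero => intro _; simpa using h0
    | succ s ihs =>
      intro hs
      have h1 := ihs (by omega)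
      have h2 := hlov (m + s) (by omega)
      have h3 := h.pos (m + s) (by omega)
      have h4 := h.pos (m + s + 1) (by omega)
      have h5 := h.pos (m + s + 2) (by omega)
      have e1 : m + (s + 1) = m + s + 1 := by ring
      have e2 : m + (s + 1) + 1 = m + s + 2 := by ring
      rw [e2, e1]
      generalize W (m + s) (m + s) = a at *
      generalize W (m + s + 1) (m + s + 1) = b at *
      generalize W (m + s + 2) (m + s + 2) = c at *
      have h6 : weight n x * b * a ≤ 2 ^ (s + 1) * c * a := by
        calc weight n x * b * a = weight n x * a * b := by ring
          _ ≤ 2 ^ s * b * b := by gcongr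
          _ = 2 ^ s * b ^ 2 := by ring
          _ ≤ 2 ^ s * (2 * (a * c)) := by gcongr
          _ = _ := by ring
      exact le_of_mul_le_mul_right h6 h3
  obtain ⟨r, rfl⟩ : ∃ r, n = m + r + 2 := ⟨n - m - 2, by omega⟩
  have h1 := hstep r (by omega)
  have h2 := hstep (r + 1) (by omega)
  have e1 : m + (r + 1) = m + r + 1 := by ring
  have e2 : m + (r + 1) + 1 = m + r + 2 := by ring
  rw [e2, e1, h.last] at h2
  have h3 := h.pos (m + r) (by omega)
  generalize W (m + r + 1) (m + r + 1) = b at *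
  have h4 : weight (m + r + 2) x ≤ 2 ^ r * b := by nlinarith
  have h5 : weight (m + r + 2) x ^ 2 ≤ 2 ^ (2 * r + 1) * volSq (m + r + 2) x := by
    calc weight (m + r + 2) x ^ 2 = weight (m + r + 2) x * weight (m + r + 2) x := by ring
      _ ≤ weight (m + r + 2) x * (2 ^ r * b) := by gcongr
      _ = 2 ^ r * (weight (m + r + 2) x * b) := by ring
      _ ≤ 2 ^ r * (2 ^ (r + 1) * volSq (m + r + 2) x) := by gcongr
      _ = _ := by rw [← mul_assoc, ← pow_add]; congr 2; ring
  have hX : 0 ≤ ∑ t ∈ range (m + r + 2), x t ^ 2 := sum_nonneg fun _ _ => sq_nonneg _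
  have h6 : volSq (m + r + 2) x ≤ weight (m + r + 2) x * (1 + ∑ t ∈ range (m + r + 2), x t ^ 2) := by
    unfold volSq; linarith
  have h7 : (2 : ℤ) ^ (2 * r + 1) < 4 ^ (m + r + 2) := by
    rw [show (4 : ℤ) = 2 ^ 2 by norm_num, ← pow_mul]
    exact pow_lt_pow_right₀ (by norm_num) (by omega)
  have h8 : weight (m + r + 2) x ^ 2 =
      4 ^ (m + r + 2) * (weight (m + r + 2) x * (1 + ∑ t ∈ range (m + r + 2), x t ^ 2)) := by
    conv_lhs => rw [sq]
    conv_lhs => lhs; rw [weight]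
    ring
  have h9 : 0 < weight (m + r + 2) x * (1 + ∑ t ∈ range (m + r + 2), x t ^ 2) := by positivity
  have h10 : (2 : ℤ) ^ (2 * r + 1) * volSq (m + r + 2) x ≤ 2 ^ (2 * r + 1) *
      (weight (m + r + 2) x * (1 + ∑ t ∈ range (m + r + 2), x t ^ 2)) := by gcongr
  nlinarith [mul_lt_mul_of_pos_right h7 h9]

theorem exists_coord_ne_zero (h : IsBasisData n x W) (hn : 1 ≤ n) :
    ∃ t < n, W 1 (n + 1 + t) ≠ 0 := by
  by_contra! hc
  have h1 := h.sq_le_mul_normSq le_rfl hn le_rfl hn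
  have h2 : normSq n x (W 1) = 0 := by
    have e1 : ∑ t ∈ range n, W 1 (n + 1 + t) ^ 2 = 0 :=
      sum_eq_zero fun t ht => by rw [hc t (mem_range.1 ht)]; simp
    have e2 : ∑ t ∈ range n, W 1 (n + 1 + t) * x t = 0 :=
      sum_eq_zero fun t ht => by rw [hc t (mem_range.1 ht)]; simp
    rw [normSq, e1, e2]; simp
  rw [h2] at h1
  nlinarith [h.pos 1 hn]

/-- If all basis vectors except the last are orthogonal to `x`, then they generate a lattice of
volume at most `‖x‖ / g`: the last vector has an inner product with `x` that is a nonzero multiple of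
`g`, which bounds the length of its orthogonal component from below. -/
theorem sq_mul_diag_le (h : IsBasisData n x W) (hn : 1 ≤ n)
    (hy : ∀ i, 1 ≤ i → i < n → ∑ t ∈ range n, W i (n + 1 + t) * x t = 0) {g : ℤ}
    (hg : ∀ t < n, g ∣ x t) : g ^ 2 * W (n - 1) (n - 1) ≤ ∑ t ∈ range n, x t ^ 2 := by
  obtain ⟨m, rfl⟩ : ∃ m, n = m + 1 := ⟨n - 1, by omega⟩
  have h1 := volSq_mul_le h le_rfl hy
  rw [h.last] at h1
  have hA := one_le_volSq (m + 1) x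
  have h2 : (∑ t ∈ range (m + 1), W (m + 1) (m + 1 + 1 + t) * x t) ^ 2 * W m m ≤
      ∑ t ∈ range (m + 1), x t ^ 2 := by
    refine le_of_mul_le_mul_right (a := volSq (m + 1) x) ?_ (by omega)
    linarith
  have hyn : ∑ t ∈ range (m + 1), W (m + 1) (m + 1 + 1 + t) * x t ≠ 0 := by
    obtain ⟨i, hi, hin, h0⟩ := h.nondeg
    rcases Nat.lt_or_ge i (m + 1) with hlt | hge
    · exact absurd (hy i hi hlt) h0
    · rwa [show i = m + 1 by omega] at h0
  have hdvd : g ∣ ∑ t ∈ range (m + 1), W (m + 1) (m + 1 + 1 + t) * x t :=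
    dvd_sum fun t ht => (hg t (mem_range.1 ht)).mul_left _
  have hle : g ^ 2 ≤ (∑ t ∈ range (m + 1), W (m + 1) (m + 1 + 1 + t) * x t) ^ 2 :=
    Int.le_of_dvd (sq_pos_of_ne_zero hyn) (pow_dvd_pow_of_dvd hdvd 2)
  have hm0 := h.pos m (by omega)
  calc g ^ 2 * W m m ≤ _ := mul_le_mul_of_nonneg_right hle hm0.le
    _ ≤ _ := h2

/-- The length of the first vector of a basis satisfying the Lovász conditions, in terms of the
volume of the sublattice generated by the first `k` basis vectors. -/
theorem diag_one_pow_le (h : IsBasisData n x W)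
    (hlov : ∀ m, m + 2 ≤ n → W (m + 1) (m + 1) ^ 2 ≤ 2 * (W m m * W (m + 2) (m + 2)))
    {k : ℕ} (hk : 1 ≤ k) (hkn : k ≤ n) :
    (W 1 1) ^ (2 * k) ≤ 2 ^ (k * (k - 1)) * W k k ^ 2 := by
  have hp : ∀ l ≤ n, (0 : ℚ) < W l l := fun l hl => by exact_mod_cast h.pos l hl
  obtain ⟨β, hβ⟩ : ∃ β : ℕ → ℚ, ∀ l, β l = W (l + 1) (l + 1) / W l l := ⟨_, fun _ => rfl⟩
  have hβ0 : β 0 = W 1 1 := by simp [hβ, h.zero_zero]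
  have hstep : ∀ l < n, β 0 ≤ 2 ^ l * β l := by
    intro l
    induction l with
    | zero => simp
    | succ l ih =>
      intro hl
      have h1 := hp l (by omega)
      have h2 := hp (l + 1) (by omega)
      have h3 : (W (l + 1) (l + 1) : ℚ) ^ 2 ≤ 2 * (W l l * W (l + 2) (l + 2)) := by
        exact_mod_cast hlov l (by omega)
      have h4 : β l ≤ 2 * β (l + 1) := by
        rw [hβ, hβ, ← mul_div_assoc, div_le_div_iff₀ h1 h2]
        simp only [show l + 1 + 1 = l + 2 from rfl]
        linarith
      calc β 0 ≤ 2 ^ l * β l := ih (by omega)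
        _ ≤ 2 ^ l * (2 * β (l + 1)) := by gcongr
        _ = _ := by ring
  have hprod : ∀ k ≤ n, ∏ l ∈ range k, β l = W k k := by
    intro k
    induction k with
    | zero => simp [h.zero_zero]
    | succ k ih =>
      intro hk
      have := (hp k (by omega)).ne'
      rw [prod_range_succ, ih (by omega), hβ]
      field_simp
  have h1 : (W 1 1 : ℚ) ^ k ≤ 2 ^ (∑ l ∈ range k, l) * W k k := by
    calc (W 1 1 : ℚ) ^ k = ∏ _l ∈ range k, β 0 := by simp [hβ0]
      _ ≤ ∏ l ∈ range k, (2 ^ l * β l) := prod_le_prod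
        (fun l _ => by rw [hβ0]; exact (hp 1 (by omega)).le)
        fun l hl => hstep l (by rw [mem_range] at hl; omega)
      _ = _ := by rw [prod_mul_distrib, hprod k hkn, prod_pow_eq_pow_sum]
  have h2 : (W 1 1) ^ k ≤ 2 ^ (∑ l ∈ range k, l) * W k k := by exact_mod_cast h1
  have h3 := h.pos 1 (by omega)
  calc W 1 1 ^ (2 * k) = (W 1 1 ^ k) ^ 2 := by rw [← pow_mul]; congr 1; ring
    _ ≤ (2 ^ (∑ l ∈ range k, l) * W k k) ^ 2 := by gcongr
    _ = _ := by rw [mul_pow, ← pow_mul, sum_range_id_mul_two]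

/-- The first vector of a basis satisfying the Lovász conditions is a short integer vector
orthogonal to `x`. -/
theorem coord_pow_le (h : IsBasisData n x W) (hn : 2 ≤ n)
    (hlov : ∀ m, m + 2 ≤ n → W (m + 1) (m + 1) ^ 2 ≤ 2 * (W m m * W (m + 2) (m + 2)))
    {g : ℤ} (hg : ∀ t < n, g ∣ x t) {t : ℕ} (ht : t < n) :
    |W 1 (n + 1 + t)| ^ (4 * (n - 1)) * g ^ 4 ≤
      2 ^ ((n - 1) * (n - 2)) * (∑ t ∈ range n, x t ^ 2) ^ 2 := by
  have hy : ∀ i, 1 ≤ i → i < n → ∑ t ∈ range n, W i (n + 1 + t) * x t = 0 :=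
    fun i hi hin => orthogonal_of_reduced h hlov hi hin
  have h1 : |W 1 (n + 1 + t)| ^ 2 ≤ W 1 1 := by
    have e : (normSq n x (W 1) : ℚ) = W 1 1 := by
      rw [cast_normSq, ← h.gram 1 1 le_rfl (by omega) le_rfl (by omega), scaledForm,
        sum_eq_single 0]
      · have : (W 1 1 : ℚ) ≠ 0 := by exact_mod_cast (h.pos 1 (by omega)).ne'
        simp [h.zero_zero, this]
      · intro l hl hl0
        rw [mem_range] at hl
        simp [h.lower 1 (l + 1) (by omega) (by omega)]
      · intro hc; rw [mem_range] at hc; omega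
    have e' : normSq n x (W 1) = W 1 1 := by exact_mod_cast e
    rw [← e', normSq, hy 1 le_rfl (by omega), sq_abs]
    simpa using single_le_sum (f := fun t => W 1 (n + 1 + t) ^ 2) (fun _ _ => sq_nonneg _)
      (mem_range.2 ht)
  have h2 := diag_one_pow_le h hlov (show 1 ≤ n - 1 by omega) (by omega)
  have h3 := sq_mul_diag_le h (by omega) hy hg
  have h4 := h.pos (n - 1) (by omega)
  calc |W 1 (n + 1 + t)| ^ (4 * (n - 1)) * g ^ 4
      = (|W 1 (n + 1 + t)| ^ 2) ^ (2 * (n - 1)) * g ^ 4 := by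
        rw [← pow_mul]; congr 2; ring
    _ ≤ W 1 1 ^ (2 * (n - 1)) * g ^ 4 := by
        refine mul_le_mul_of_nonneg_right (pow_le_pow_left₀ (by positivity) h1 _) (by positivity)
    _ ≤ 2 ^ ((n - 1) * (n - 1 - 1)) * W (n - 1) (n - 1) ^ 2 * g ^ 4 :=
        mul_le_mul_of_nonneg_right h2 (by positivity)
    _ = 2 ^ ((n - 1) * (n - 2)) * (g ^ 2 * W (n - 1) (n - 1)) ^ 2 := by
        rw [show n - 1 - 1 = n - 2 by omega]; ring
    _ ≤ _ := by gcongr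

end

/-! ### The initial basis -/

/-- The data of the initial basis `(e_i, √Γ x_i)`. -/
def initData (n : ℕ) (x : ℕ → ℤ) : ℕ → ℕ → ℤ := fun i j =>
  if i = 0 then if j = 0 then 1 else 0
  else if n < i ∨ j = 0 then 0
  else if j < i then weight n x * x (i - 1) * x (j - 1)
  else if j = i then 1 + weight n x * ∑ t ∈ range i, x t ^ 2
  else if j = n + i then 1 else 0

section

variable {n : ℕ} {x : ℕ → ℤ}

theorem initData_diag {i : ℕ} (hi : i ≤ n) :
    initData n x i i = 1 + weight n x * ∑ t ∈ range i, x t ^ 2 := by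
  rcases Nat.eq_zero_or_pos i with rfl | h
  · simp [initData]
  · simp [initData, h.ne', hi]

theorem initData_coord {i t : ℕ} (hi : i < n) :
    initData n x (i + 1) (n + 1 + t) = if t = i then 1 else 0 := by
  have h1 : ¬ (n < i + 1 ∨ n + 1 + t = 0) := by omega
  have h2 : ¬ (n + 1 + t < i + 1) := by omega
  have h3 : n + 1 + t ≠ i + 1 := by omega
  have h4 : n + 1 + t = n + (i + 1) ↔ t = i := by omega
  simp only [initData, h1, h2, h3, h4, if_false, Nat.succ_ne_zero]

theorem initData_lower {i j : ℕ} (hij : i < j) (hj : j ≤ n) : initData n x i j = 0 := by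
  simp only [initData]
  split_ifs <;> first | rfl | omega

theorem sum_initData_coord_mul {i : ℕ} (hi : i < n) (y : ℕ → ℚ) :
    ∑ t ∈ range n, castRow (initData n x (i + 1)) (n + 1 + t) * y t = y i := by
  simp only [castRow, initData_coord hi]
  simp [hi]

theorem gram_initData_of_le {a b : ℕ} (hab : b ≤ a) (ha : a < n) :
    scaledForm n (fun l => initData n x l l) (castRow (initData n x (a + 1)))
      (castRow (initData n x (b + 1))) =
    (if a = b then 1 else 0) + weight n x * x a * x b := by
  obtain ⟨d, hd⟩ : ∃ d : ℕ → ℚ, ∀ l, d l = 1 + weight n x * ∑ t ∈ range l, (x t : ℚ) ^ 2 :=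
    ⟨_, fun _ => rfl⟩
  have hdiag : ∀ l ≤ n, (initData n x l l : ℚ) = d l := fun l hl => by
    rw [initData_diag hl, hd]; push_cast; rfl
  have hw : (0 : ℚ) < weight n x := by exact_mod_cast weight_pos n x
  have hpos : ∀ l, 0 < d l := fun l => by
    have : 0 ≤ ∑ t ∈ range l, (x t : ℚ) ^ 2 := sum_nonneg fun _ _ => sq_nonneg _
    rw [hd]; positivity
  have hsucc : ∀ l, d (l + 1) = d l + weight n x * (x l : ℚ) ^ 2 := fun l => by
    rw [hd, hd, sum_range_succ]; ring
  have hlow : ∀ i l, l < i → i < n →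
      (initData n x (i + 1) (l + 1) : ℚ) = weight n x * x i * x l := fun i l hl hi => by
    have h1 : ¬ (n < i + 1 ∨ l + 1 = 0) := by omega
    have h2 : l + 1 < i + 1 := by omega
    simp [initData, hi, hl]
  -- a telescoping sum
  have htel : ∀ m, ∑ l ∈ range m, weight n x * (x l : ℚ) ^ 2 / (d l * d (l + 1)) = 1 - 1 / d m := by
    intro m
    induction m with
    | zero => simp [hd]
    | succ m ih =>
      rw [sum_range_succ, ih]
      have h1 := (hpos m).ne'
      have h2 := (hpos (m + 1)).ne'
      have h3 : (weight n x : ℚ) * (x m : ℚ) ^ 2 = d (m + 1) - d m := by rw [hsucc]; ring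
      rw [h3]
      field_simp
      ring
  have hsum : scaledForm n (fun l => initData n x l l) (castRow (initData n x (a + 1)))
      (castRow (initData n x (b + 1))) =
      weight n x * x a * x b * (1 - 1 / d b) + initData n x (a + 1) (b + 1) / d b := by
    rw [← htel, mul_sum, scaledForm, ← sum_subset (range_subset_range.2 (by omega : b + 1 ≤ n)),
      sum_range_succ]
    · congr 1
      · refine sum_congr rfl fun l hl => ?_
        rw [mem_range] at hl
        simp only [castRow]
        rw [hlow a l (by omega) ha, hlow b l hl (by omega), hdiag l (by omega),
          hdiag (l + 1) (by omega)]
        ring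
      · simp only [castRow]
        rw [hdiag b (by omega), hdiag (b + 1) (by omega)]
        have h1 := (hpos b).ne'
        have h2 := (hpos (b + 1)).ne'
        field_simp
    · intro l hl hl'
      rw [mem_range] at hl hl'
      simp [initData_lower (show b + 1 < l + 1 by omega) (by omega : l + 1 ≤ n)]
  rw [hsum]
  have h1 := (hpos b).ne'
  rcases eq_or_ne a b with rfl | hne
  · rw [hdiag _ (by omega), hsucc, if_pos rfl]
    field_simp
    ring
  · rw [hlow a b (by omega) ha, if_neg hne]
    field_simp
    ring

theorem isBasisData_initData (hx : ∃ t < n, x t ≠ 0) : IsBasisData n x (initData n x) := by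
  have hw := weight_pos n x
  have hsum : ∀ i, 0 ≤ ∑ t ∈ range i, x t ^ 2 := fun i => sum_nonneg fun _ _ => sq_nonneg _
  refine ⟨by simp [initData], fun i j hij hj => initData_lower hij hj, fun i hi => ?_,
    fun i hi => ?_, by rw [initData_diag le_rfl, volSq], ?_, ?_, fun i hi => ?_, fun j hj => ?_,
    fun i j hi => ?_, fun i j hj => ?_⟩
  · rw [initData_diag hi]
    have := hsum i
    positivity
  · rw [initData_diag hi, volSq]
    have : ∑ t ∈ range i, x t ^ 2 ≤ ∑ t ∈ range n, x t ^ 2 :=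
      sum_le_sum_of_subset_of_nonneg (range_subset_range.2 hi) fun _ _ _ => sq_nonneg _
    gcongr
  · intro i j hi hin hj hjn
    obtain ⟨a, rfl⟩ : ∃ a, i = a + 1 := ⟨i - 1, by omega⟩
    obtain ⟨b, rfl⟩ : ∃ b, j = b + 1 := ⟨j - 1, by omega⟩
    have hR : latticeForm n (castRow x) (weight n x) (castRow (initData n x (a + 1)))
        (castRow (initData n x (b + 1))) =
        (if a = b then 1 else 0) + weight n x * x a * x b := by
      simp only [latticeForm]
      rw [sum_initData_coord_mul (by omega),
        sum_initData_coord_mul (by omega), sum_initData_coord_mul (by omega)]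
      simp only [castRow, initData_coord (show b < n by omega)]
      push_cast
      rfl
    rw [hR]
    rcases le_total b a with hab | hab
    · exact gram_initData_of_le hab (by omega)
    · rw [scaledForm_comm, gram_initData_of_le hab (by omega)]
      simp only [eq_comm (a := b)]
      ring
  · obtain ⟨t, ht, hxt⟩ := hx
    refine ⟨t + 1, by omega, by omega, ?_⟩
    simp only [initData_coord ht]
    simpa [ht] using hxt
  · simp [initData]; omega
  · simp [initData]; omega
  · simp [initData, hi]; omega
  · simp only [initData]
    split_ifs <;> first | rfl | omega

theorem normSq_initData_le {i : ℕ} (hi : 1 ≤ i) (hin : i ≤ n) :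
    normSq n x (initData n x i) ≤ n * volSq n x := by
  obtain ⟨a, rfl⟩ : ∃ a, i = a + 1 := ⟨i - 1, by omega⟩
  have e : normSq n x (initData n x (a + 1)) = 1 + weight n x * x a ^ 2 := by
    simp only [normSq, initData_coord (show a < n by omega)]
    simp [show a < n by omega]
  have h1 : x a ^ 2 ≤ ∑ t ∈ range n, x t ^ 2 :=
    single_le_sum (f := fun t => x t ^ 2) (fun _ _ => sq_nonneg _) (mem_range.2 (by omega))
  have h2 := one_le_volSq n x
  have h3 : 1 + weight n x * x a ^ 2 ≤ volSq n x := by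
    have := weight_pos n x
    unfold volSq; gcongr
  have h4 : (1 : ℤ) ≤ n := by exact_mod_cast (by omega : 1 ≤ n)
  rw [e]; nlinarith

end

end LLL

/-! ### The program -/

namespace RAM

open LLL

@[simp] theorem State.setVar_var (s : State) (v w : ℕ) (z : ℤ) :
    (s.setVar v z).var w = if w = v then z else s.var w := by
  simp [State.setVar, Function.update_apply]

@[simp] theorem State.setVar_arr (s : State) (v : ℕ) (z : ℤ) : (s.setVar v z).arr = s.arr := rfl

@[simp] theorem State.setArr_var (s : State) (a : ℕ) (i z : ℤ) : (s.setArr a i z).var = s.var :=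
  rfl

theorem State.setArr_arr (s : State) (a b : ℕ) (i j z : ℤ) :
    (s.setArr a i z).arr b j = if b = a ∧ j = i then z else s.arr b j := by
  simp only [State.setArr, Function.update_apply]
  split_ifs <;> simp_all

/-- The address of the matrix entry with indices `i` and `j`. It is injective in the pair `(i, j)`,
so that the layout does not depend on the dimension. -/
def cell (i j : ℕ) : ℤ := (((i + j) * (i + j) + j : ℕ) : ℤ)

theorem cell_inj {i j i' j' : ℕ} : cell i j = cell i' j' ↔ i = i' ∧ j = j' := by
  refine ⟨fun h => ?_, fun h => by rw [h.1, h.2]⟩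
  have h : (i + j) * (i + j) + j = (i' + j') * (i' + j') + j' := by
    simpa only [cell, Nat.cast_inj] using h
  have hs : i + j = i' + j' := by
    rcases lt_trichotomy (i + j) (i' + j') with hlt | heq | hgt
    · nlinarith
    · exact heq
    · nlinarith
  rw [hs] at h
  omega

/-- The matrix stored in the array `2`. -/
def State.mat (s : State) : ℕ → ℕ → ℤ := fun i j => s.arr 2 (cell i j)

@[simp] theorem State.mat_setVar (s : State) (v : ℕ) (z : ℤ) : (s.setVar v z).mat = s.mat := rfl

theorem State.mat_setArr (s : State) (i j : ℕ) (z : ℤ) (r c : ℕ) :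
    (s.setArr 2 (cell i j) z).mat r c = if r = i ∧ c = j then z else s.mat r c := by
  simp [State.mat, State.setArr_arr, cell_inj]

theorem State.mat_setArr_of_ne (s : State) {a : ℕ} (ha : a ≠ 2) (i z : ℤ) :
    (s.setArr a i z).mat = s.mat := by
  ext r c
  simp [State.mat, State.setArr_arr, ha.symm]

namespace Expr

/-- The expression computing `cell`. -/
def addr (e f : Expr) : Expr := .op .add (.op .mul (.op .add e f) (.op .add e f)) f

/-- The expression reading a matrix entry. -/
def entry (e f : Expr) : Expr := .read 2 (addr e f)

theorem eval_addr {s : State} {e f : Expr} {i j : ℕ} (he : e.eval s = i) (hf : f.eval s = j) :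
    (addr e f).eval s = cell i j := by
  simp [addr, eval, Op.eval, he, hf, cell]

theorem eval_entry {s : State} {e f : Expr} {i j : ℕ} (he : e.eval s = i) (hf : f.eval s = j) :
    (entry e f).eval s = s.mat i j := by
  rw [entry, eval, eval_addr he hf, State.mat]

end Expr

open RAM.Expr

/-- Subtract `v₄` times the row `v₃` of the matrix from the row `v₂`. -/
def subRowProg : Prog :=
  forLoop 5 (.const 0) (.op .add (.op .mul (.const 2) (.var 0)) (.const 1))
    (.store 2 (addr (.var 2) (.var 5))
      (.op .sub (entry (.var 2) (.var 5)) (.op .mul (.var 4) (entry (.var 3) (.var 5)))))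

/-- Size reduction of the row `v₂`. -/
def reduceProg : Prog :=
  .seq (.assign 3 (.op .sub (.var 2) (.const 1)))
    (.loop (.op .lt (.const 0) (.var 3))
      (.seq
        (.assign 4 (.op .div
          (.op .add (.op .mul (.const 2) (entry (.var 2) (.var 3))) (entry (.var 3) (.var 3)))
          (.op .mul (.const 2) (entry (.var 3) (.var 3)))))
        (.seq subRowProg (.assign 3 (.op .sub (.var 3) (.const 1))))))

/-- Exchange the rows `v₂` and `v₃`. -/
def swapRowsProg : Prog :=
  forLoop 5 (.const 0) (.op .add (.op .mul (.const 2) (.var 0)) (.const 1))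
    (.seq (.assign 6 (entry (.var 3) (.var 5)))
      (.seq (.store 2 (addr (.var 3) (.var 5)) (entry (.var 2) (.var 5)))
        (.store 2 (addr (.var 2) (.var 5)) (.var 6))))

/-- Transform the columns `v₂` and `v₃` after the exchange of rows. -/
def swapColsProg : Prog :=
  forLoop 5 (.const 0) (.op .add (.var 0) (.const 1))
    (.seq (.assign 6 (entry (.var 5) (.var 3)))
      (.seq (.assign 11 (entry (.var 5) (.var 2)))
        (.seq
          (.store 2 (addr (.var 5) (.var 3))
            (.op .div (.op .add (.op .mul (.var 10) (.var 11)) (.op .mul (.var 7) (.var 6)))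
              (.var 9)))
          (.store 2 (addr (.var 5) (.var 2))
            (.op .div (.op .sub (.op .mul (.var 8) (.var 6)) (.op .mul (.var 7) (.var 11)))
              (.var 9))))))

/-- One round of the basis reduction: reduce the row `v₂`, then either exchange it with the
preceding row and step back or go on to the next row. -/
def roundProg : Prog :=
  .seq reduceProg
    (.seq (.assign 3 (.op .sub (.var 2) (.const 1)))
    (.seq (.assign 7 (entry (.var 2) (.var 3)))
    (.seq (.assign 8 (entry (.var 2) (.var 2)))
    (.seq (.assign 9 (entry (.var 3) (.var 3)))
    (.seq (.assign 10 (entry (.op .sub (.var 3) (.const 1)) (.op .sub (.var 3) (.const 1))))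
    (.ite
      (.op .lt
        (.op .mul (.const 4) (.op .add (.op .mul (.var 10) (.var 8)) (.op .mul (.var 7) (.var 7))))
        (.op .mul (.const 3) (.op .mul (.var 9) (.var 9))))
      (.seq swapRowsProg (.seq swapColsProg
        (.ite (.op .lt (.const 2) (.var 2)) (.assign 2 (.op .sub (.var 2) (.const 1))) .skip)))
      (.assign 2 (.op .add (.var 2) (.const 1)))))))))

/-- The basis reduction. -/
def lllProg : Prog :=
  .seq (.assign 2 (.const 2)) (.loop (.op .lt (.var 2) (.op .add (.var 0) (.const 1))) roundProg)

/-- Compute the weight `Γ` in `v₁`. -/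
def weightProg : Prog :=
  .seq (.assign 1 (.const 1))
    (.seq
      (forLoop 5 (.const 0) (.var 0)
        (.assign 1 (.op .add (.var 1) (.op .mul (.read 0 (.var 5)) (.read 0 (.var 5))))))
      (forLoop 5 (.const 0) (.var 0) (.assign 1 (.op .mul (.const 4) (.var 1)))))

/-- Write the row `v₃` of the initial matrix; `v₆` holds the preceding diagonal entry. -/
def initRowProg : Prog :=
  .seq (.assign 6 (.op .add (.var 6) (.op .mul (.var 1)
      (.op .mul (.read 0 (.op .sub (.var 3) (.const 1))) (.read 0 (.op .sub (.var 3) (.const 1)))))))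
    (.seq
      (forLoop 5 (.const 1) (.var 3)
        (.store 2 (addr (.var 3) (.var 5))
          (.op .mul (.op .mul (.var 1) (.read 0 (.op .sub (.var 3) (.const 1))))
            (.read 0 (.op .sub (.var 5) (.const 1))))))
      (.seq (.store 2 (addr (.var 3) (.var 3)) (.var 6))
        (.store 2 (addr (.var 3) (.op .add (.var 0) (.var 3))) (.const 1))))

/-- Write the initial matrix. -/
def initProg : Prog :=
  .seq weightProg
    (.seq (.store 2 (addr (.const 0) (.const 0)) (.const 1))
      (.seq (.assign 6 (.const 1))
        (forLoop 3 (.const 1) (.op .add (.var 0) (.const 1)) initRowProg)))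

/-- Copy the coordinates of the first basis vector to the output array. -/
def outputProg : Prog :=
  forLoop 5 (.const 0) (.var 0)
    (.store 1 (.var 5) (entry (.const 1) (.op .add (.op .add (.var 0) (.const 1)) (.var 5))))

/-- The program: basis reduction by integer arithmetic, started from the basis
`(e_i, √Γ x_i)`. -/
def shortRelationProg : Prog := .seq initProg (.seq lllProg outputProg)

/-! ### Correctness of the row and column operations -/

variable {S n : ℕ} {s : State} {x : ℕ → ℤ}

theorem runs_subRowProg {k l : ℕ} (hn : s.var 0 = n) (hk : s.var 2 = k) (hl : s.var 3 = l)
    (hlk : l ≠ k) (hS : 2 * n + 1 < 2 ^ S) (hcols : ∀ i j, 2 * n < j → s.mat i j = 0)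
    (hB : ∀ j, |subRow s.mat k l (s.var 4) k j| < 2 ^ S) :
    Runs S (2 * n + 2) subRowProg s fun s' =>
      (∀ v, v ≠ 5 → s'.var v = s.var v) ∧ s'.mat = subRow s.mat k l (s.var 4) := by
  refine (Runs.forLoop (K := 1) (a := 0) (b := 2 * n + 1) (m := 2 * n + 2)
    (fun j s' => s'.var 5 = j ∧ (∀ v, v ≠ 5 → s'.var v = s.var v) ∧ ∀ r c, s'.mat r c =
      if c < j then subRow s.mat k l (s.var 4) r c else s.mat r c) le_rfl
    (by simp [eval]) (by omega) hS (by omega) ?_ ?_ ?_ ?_).mono (by omega) fun _ h => h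
  · rintro i s' ⟨h5, hv, -⟩
    exact ⟨h5, by simp [eval, Op.eval, hv 0, hn]⟩
  · exact ⟨by simp, fun v hv => by simp [hv], fun r c => by simp⟩
  · rintro j s' - hj ⟨h5, hv, hm⟩
    have e2 : (Expr.var 2).eval s' = (k : ℕ) := by simp [eval, hv 2, hk]
    have e3 : (Expr.var 3).eval s' = (l : ℕ) := by simp [eval, hv 3, hl]
    have e5 : (Expr.var 5).eval s' = (j : ℕ) := by simp [eval, h5]
    have ev : (Expr.op .sub (entry (.var 2) (.var 5))
        (.op .mul (.var 4) (entry (.var 3) (.var 5)))).eval s' =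
        subRow s.mat k l (s.var 4) k j := by
      rw [eval, eval, eval_entry e2 e5, eval_entry e3 e5, hm, hm, subRow_self]
      simp [Op.eval, eval, hv 4]
    refine Runs.store le_rfl (by rw [ev]; exact hB j) ?_
    rw [ev, eval_addr e2 e5]
    refine ⟨by simpa using h5, by simp, fun v hv' => by simp [hv', hv v hv'], fun r c => ?_⟩
    rw [State.mat_setVar, State.mat_setArr, hm]
    by_cases hr : r = k
    · subst hr
      split_ifs with h1 h2 h3 h4
      · rw [h1.2]
      · omega
      · rfl
      · omega
      · omega
      · rfl
    · simp [hr, subRow_of_ne _ _ _ hr]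
  · rintro s' ⟨h5, hv, hm⟩
    refine ⟨hv, ?_⟩
    ext r c
    rw [hm]
    split_ifs with hc
    · rfl
    · have h1 : ∀ i, s.mat i c = 0 := fun i => hcols i c (by omega)
      by_cases hr : r = k
      · subst hr; rw [subRow_self, h1, h1]; simp
      · rw [subRow_of_ne _ _ _ hr]

theorem runs_swapRowsProg {m : ℕ} (hn : s.var 0 = n) (h2 : s.var 2 = (m + 2 : ℕ))
    (h3 : s.var 3 = (m + 1 : ℕ)) (hS : 2 * n + 1 < 2 ^ S)
    (hcols : ∀ i j, 2 * n < j → s.mat i j = 0) (hB : ∀ i j, i ≤ m + 2 → |s.mat i j| < 2 ^ S) :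
    Runs S (2 * n + 2) swapRowsProg s fun s' =>
      (∀ v, v ≠ 5 → v ≠ 6 → s'.var v = s.var v) ∧ s'.mat = swapRows s.mat m := by
  refine (Runs.forLoop (K := 1) (a := 0) (b := 2 * n + 1) (m := 2 * n + 2)
    (fun j s' => s'.var 5 = j ∧ (∀ v, v ≠ 5 → v ≠ 6 → s'.var v = s.var v) ∧
      ∀ r c, s'.mat r c = if c < j then swapRows s.mat m r c else s.mat r c) le_rfl
    (by simp [eval]) (by omega) hS (by omega) ?_ ?_ ?_ ?_).mono (by omega) fun _ h => h
  · rintro i s' ⟨h5, hv, -⟩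
    exact ⟨h5, by simp [eval, Op.eval, hv 0, hn]⟩
  · exact ⟨by simp, fun v hv _ => by simp [hv], fun r c => by simp⟩
  · rintro j s' - hj ⟨h5, hv, hm⟩
    have ev1 : (entry (.var 3) (.var 5)).eval s' = s.mat (m + 1) j := by
      rw [eval_entry (i := m + 1) (j := j) (by simp [eval, hv 3, h3]) (by simp [eval, h5]), hm]
      simp
    refine Runs.seq (Runs.assign le_rfl (by rw [ev1]; exact hB _ _ (by omega)) ?_)
    rw [ev1]
    have ev2 : (entry (.var 2) (.var 5)).eval (s'.setVar 6 (s.mat (m + 1) j)) =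
        s.mat (m + 2) j := by
      rw [eval_entry (i := m + 2) (j := j) (by simp [eval, hv 2, h2]) (by simp [eval, h5]),
        State.mat_setVar, hm]
      simp
    refine Runs.seq (Runs.store le_rfl (by rw [ev2]; exact hB _ _ (by omega)) ?_)
    rw [ev2, eval_addr (i := m + 1) (j := j) (by simp [eval, hv 3, h3]) (by simp [eval, h5])]
    refine Runs.store le_rfl (by simpa [eval] using hB (m + 1) j (by omega)) ?_
    rw [eval_addr (i := m + 2) (j := j) (by simp [eval, hv 2, h2]) (by simp [eval, h5])]
    refine ⟨by simpa using h5, by simp, fun v h1 h2 => by simp [h1, h2, hv v h1 h2],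
      fun r c => ?_⟩
    simp only [State.mat_setVar, State.mat_setArr, hm, eval, State.setArr_var, State.setVar_var,
      if_true, swapRows]
    split_ifs <;> first | rfl | omega | (congr 1; omega)
  · rintro s' ⟨h5, hv, hm⟩
    refine ⟨hv, ?_⟩
    ext r c
    rw [hm]
    split_ifs with hc
    · rfl
    · have h1 : ∀ i, s.mat i c = 0 := fun i => hcols i c (by omega)
      rw [swapRows_eq, h1, h1]

theorem runs_swapColsProg {m : ℕ} {W : ℕ → ℕ → ℤ} (hn : s.var 0 = n)
    (h2 : s.var 2 = (m + 2 : ℕ)) (h3 : s.var 3 = (m + 1 : ℕ)) (h7 : s.var 7 = W (m + 2) (m + 1))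
    (h8 : s.var 8 = W (m + 2) (m + 2)) (h9 : s.var 9 = W (m + 1) (m + 1))
    (h10 : s.var 10 = W m m) (hmat : s.mat = swapRows W m) (hS : n + 1 < 2 ^ S)
    (hrows : ∀ i j, n < i → swapRows W m i j = 0) (hrows' : ∀ i j, n < i → swapStep W m i j = 0)
    (hB : ∀ i j, i ≤ n → |swapRows W m i j| < 2 ^ S)
    (hB' : ∀ i j, i ≤ n → |swapStep W m i j| < 2 ^ S) :
    Runs S (n + 2) swapColsProg s fun s' =>
      (∀ v, v ≠ 5 → v ≠ 6 → v ≠ 11 → s'.var v = s.var v) ∧ s'.mat = swapStep W m := by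
  refine (Runs.forLoop (K := 1) (a := 0) (b := n + 1) (m := n + 2)
    (fun j s' => s'.var 5 = j ∧ (∀ v, v ≠ 5 → v ≠ 6 → v ≠ 11 → s'.var v = s.var v) ∧
      ∀ r c, s'.mat r c = if r < j then swapStep W m r c else swapRows W m r c) le_rfl
    (by simp [eval]) (by omega) hS (by omega) ?_ ?_ ?_ ?_).mono (by omega) fun _ h => h
  · rintro i s' ⟨h5, hv, -⟩
    exact ⟨h5, by simp [eval, Op.eval, hv 0, hn]⟩
  · exact ⟨by simp, fun v hv _ => by simp [hv], fun r c => by simp [hmat]⟩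
  · rintro j s' - hj ⟨h5, hv, hm⟩
    have ev1 : (entry (.var 5) (.var 3)).eval s' = swapRows W m j (m + 1) := by
      rw [eval_entry (i := j) (j := m + 1) (by simp [eval, h5]) (by simp [eval, hv 3, h3]), hm]
      simp
    refine Runs.seq (Runs.assign le_rfl (by rw [ev1]; exact hB _ _ (by omega)) ?_)
    rw [ev1]
    obtain ⟨s₁, hs₁⟩ : ∃ s₁, s₁ = s'.setVar 6 (swapRows W m j (m + 1)) := ⟨_, rfl⟩
    rw [← hs₁]
    have ev2 : (entry (.var 5) (.var 2)).eval s₁ = swapRows W m j (m + 2) := by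
      rw [eval_entry (i := j) (j := m + 2) (by simp [eval, h5, hs₁])
        (by simp [eval, hv 2, h2, hs₁]), hs₁, State.mat_setVar, hm]
      simp
    refine Runs.seq (Runs.assign le_rfl (by rw [ev2]; exact hB _ _ (by omega)) ?_)
    rw [ev2]
    obtain ⟨s₂, hs₂⟩ : ∃ s₂, s₂ = s₁.setVar 11 (swapRows W m j (m + 2)) := ⟨_, rfl⟩
    rw [← hs₂]
    have hvar : ∀ v, v ≠ 6 → v ≠ 11 → s₂.var v = s'.var v := fun v hv1 hv2 => by
      simp [hs₂, hs₁, hv1, hv2]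
    have w6 : s₂.var 6 = swapRows W m j (m + 1) := by simp [hs₂, hs₁]
    have w11 : s₂.var 11 = swapRows W m j (m + 2) := by simp [hs₂]
    have ev3 : (Expr.op .div (.op .add (.op .mul (.var 10) (.var 11)) (.op .mul (.var 7) (.var 6)))
        (.var 9)).eval s₂ = swapStep W m j (m + 1) := by
      simp [eval, Op.eval, hvar, hv, w6, w11, h7, h9, h10, swapStep]
    refine Runs.seq (Runs.store le_rfl (by rw [ev3]; exact hB' _ _ (by omega)) ?_)
    rw [ev3, eval_addr (i := j) (j := m + 1) (by simp [eval, hvar, h5])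
      (by simp [eval, hvar, hv, h3])]
    obtain ⟨s₃, hs₃⟩ : ∃ s₃, s₃ = s₂.setArr 2 (cell j (m + 1)) (swapStep W m j (m + 1)) := ⟨_, rfl⟩
    rw [← hs₃]
    have hvar₃ : s₃.var = s₂.var := by rw [hs₃, State.setArr_var]
    have ev4 : (Expr.op .div (.op .sub (.op .mul (.var 8) (.var 6)) (.op .mul (.var 7) (.var 11)))
        (.var 9)).eval s₃ = swapStep W m j (m + 2) := by
      simp [eval, Op.eval, hvar₃, hvar, hv, w6, w11, h7, h9, h8, swapStep]
    refine Runs.store le_rfl (by rw [ev4]; exact hB' _ _ (by omega)) ?_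
    rw [ev4, eval_addr (i := j) (j := m + 2) (by simp [eval, hvar₃, hvar, h5])
      (by simp [eval, hvar₃, hvar, hv, h2])]
    refine ⟨by simp [hvar₃, hvar, h5], by simp, fun v a1 a2 a3 => by
      simp [a1, hvar₃, hvar v a2 a3, hv v a1 a2 a3], fun r c => ?_⟩
    have hm₂ : s₂.mat = s'.mat := by rw [hs₂, hs₁]; rfl
    rw [State.mat_setVar, State.mat_setArr, hs₃, State.mat_setArr, hm₂, hm]
    by_cases hr : r = j
    · subst hr
      simp only [true_and, lt_irrefl, if_false, Nat.lt_succ_self, if_true]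
      split_ifs with c1 c2
      · rw [c1]
      · rw [c2]
      · simp [swapStep, c1, c2]
    · have : r < j + 1 ↔ r < j := by omega
      simp [hr, this]
  · rintro s' ⟨h5, hv, hm⟩
    refine ⟨hv, ?_⟩
    ext r c
    rw [hm]
    split_ifs with hc
    · rfl
    · rw [hrows r c (by omega), hrows' r c (by omega)]

end RAM

/-! ### Correctness of the basis reduction -/

namespace RAM

open LLL RAM.Expr

/-- The invariant of the basis reduction: the matrix holds a basis of short vectors. -/
structure IsShortBasis (n : ℕ) (x : ℕ → ℤ) (W : ℕ → ℕ → ℤ) : Prop where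
  data : IsBasisData n x W
  short : ∀ i, 1 ≤ i → i ≤ n → normSq n x (W i) ≤ n * volSq n x

/-- A bound for the entries of the matrix between the rounds of the basis reduction. -/
def entryBound (n : ℕ) (x : ℕ → ℤ) : ℤ := n * volSq n x ^ 3

variable {S n : ℕ} {s : State} {x : ℕ → ℤ}

theorem IsShortBasis.abs_le {W : ℕ → ℕ → ℤ} (h : IsShortBasis n x W) (hn : 1 ≤ n) (i j : ℕ) :
    |W i j| ≤ entryBound n x := by
  rcases le_or_gt i n with hi | hi
  · exact h.data.abs_le hi (fun h1 => h.short i h1 hi) hn j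
  · have := one_le_volSq n x
    rw [h.data.rows i j hi, entryBound]
    simp only [abs_zero]
    positivity

theorem le_entryBound (n : ℕ) (x : ℕ → ℤ) : (n : ℤ) ≤ entryBound n x := by
  have h1 := one_le_volSq n x
  have h2 : (1 : ℤ) ≤ volSq n x ^ 3 := one_le_pow₀ h1
  unfold entryBound
  nlinarith [Int.natCast_nonneg n]

theorem volSq_le_entryBound (hn : 1 ≤ n) (x : ℕ → ℤ) : volSq n x ≤ entryBound n x := by
  have h1 := one_le_volSq n x
  have h2 : volSq n x ≤ volSq n x ^ 3 := le_self_pow₀ h1 (by norm_num)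
  have h3 : (1 : ℤ) ≤ n := by exact_mod_cast hn
  unfold entryBound
  nlinarith

theorem pow_lt_of_bits {a : ℕ} (hS : (entryBound n x + 2) ^ (n + 2) ≤ 2 ^ S) (ha : a < n + 2) :
    (entryBound n x + 2) ^ a < 2 ^ S := by
  have h0 := le_entryBound n x
  exact (pow_lt_pow_right₀ (by omega) ha).trans_le hS

theorem entryBound_add_lt (hS : (entryBound n x + 2) ^ (n + 2) ≤ 2 ^ S) :
    entryBound n x + 2 < 2 ^ S := by
  simpa using pow_lt_of_bits (a := 1) hS (by omega)

theorem two_mul_add_one_lt (hn : 1 ≤ n) (hS : (entryBound n x + 2) ^ (n + 2) ≤ 2 ^ S) :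
    2 * n + 1 < 2 ^ S := by
  have h0 := le_entryBound n x
  have h1 := pow_lt_of_bits (a := 2) hS (by omega)
  zify
  nlinarith

/-- During the reduction of the row `k` its entries grow by a factor of at most `M + 2` for each row
that is subtracted, where `M` bounds the other entries; afterwards the row is short again. -/
theorem runs_reduceProg {k : ℕ} (hn : s.var 0 = n) (hk : s.var 2 = k) (h2k : 2 ≤ k) (hkn : k ≤ n)
    (h : IsShortBasis n x s.mat) (hS : (entryBound n x + 2) ^ (n + 2) ≤ 2 ^ S) :
    Runs S ((2 * n + 2) * n) reduceProg s fun s' =>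
      (∀ v ≤ 2, s'.var v = s.var v) ∧ IsShortBasis n x s'.mat ∧
        ∀ i, s'.mat i i = s.mat i i ∧ (i ≠ k → s'.mat i = s.mat i) ∧
          (1 ≤ i → i < k → 2 * |s'.mat k i| ≤ s'.mat i i) := by
  have hn1 : 1 ≤ n := by omega
  obtain ⟨M, hM⟩ : ∃ M, M = entryBound n x := ⟨_, rfl⟩
  have hM0 : (n : ℤ) ≤ M := by rw [hM]; exact le_entryBound n x
  have hS1 := two_mul_add_one_lt hn1 hS
  have hpow : ∀ a < n + 2, (M + 2) ^ a < 2 ^ S := fun a ha => by rw [hM]; exact pow_lt_of_bits hS ha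
  have ev3 : (Expr.op .sub (.var 2) (.const 1)).eval s = ((k - 1 : ℕ) : ℤ) := by
    simp [eval, Op.eval, hk]; omega
  refine Runs.seq (Runs.assign (by nlinarith) ?_ ?_)
  · rw [ev3, Nat.abs_cast]
    have := hpow 1 (by omega)
    have : ((k - 1 : ℕ) : ℤ) ≤ n := by exact_mod_cast (by omega : k - 1 ≤ n)
    linarith
  rw [ev3]
  refine Runs.loop (fun s' => ∃ l < k, s'.var 3 = l ∧ (∀ v ≤ 2, s'.var v = s.var v) ∧
      IsBasisData n x s'.mat ∧ (∀ i, s'.mat i i = s.mat i i) ∧ (∀ i, i ≠ k → s'.mat i = s.mat i) ∧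
      (∀ i, l < i → i < k → 2 * |s'.mat k i| ≤ s'.mat i i) ∧
      ∀ j, |s'.mat k j| + 1 ≤ (M + 2) ^ (k - l)) (fun s' => (s'.var 3).toNat) (by omega) ?_ ?_ ?_ ?_
  · rintro s' ⟨l, hlk, h3, hv, hd, hdiag, hrow, hred, hb⟩ hne
    have hl : 1 ≤ l := by
      by_contra hc
      apply hne
      have : l = 0 := by omega
      simp [eval, Op.eval, h3, this]
    have hpos := hd.pos l (by omega)
    have e2 : (Expr.var 2).eval s' = (k : ℕ) := by simp [eval, hv 2, hk]
    have e3 : (Expr.var 3).eval s' = (l : ℕ) := by simp [eval, h3]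
    obtain ⟨q, hq⟩ : ∃ q, q = (2 * s'.mat k l + s'.mat l l) / (2 * s'.mat l l) := ⟨_, rfl⟩
    have ev4 : (Expr.op .div
          (.op .add (.op .mul (.const 2) (entry (.var 2) (.var 3))) (entry (.var 3) (.var 3)))
          (.op .mul (.const 2) (entry (.var 3) (.var 3)))).eval s' = q := by
      simp only [eval, Op.eval, eval_entry e2 e3, eval_entry e3 e3, hq]
    have hqb : |q| ≤ (M + 2) ^ (k - l) := by
      rw [hq]; exact (abs_round_le _ hpos).trans (hb l)
    have hsub : ∀ j, |subRow s'.mat k l q k j| + 1 ≤ (M + 2) ^ (k - (l - 1)) := by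
      intro j
      have h1 : |s'.mat l j| ≤ M := by
        rw [hrow l hlk.ne, hM]; exact h.abs_le hn1 l j
      have h2 := hb j
      have h4 : |q * s'.mat l j| ≤ (M + 2) ^ (k - l) * M := by
        rw [abs_mul]; exact mul_le_mul hqb h1 (abs_nonneg _) ((abs_nonneg _).trans hqb)
      have h5 := abs_sub (s'.mat k j) (q * s'.mat l j)
      have h6 : (1 : ℤ) ≤ (M + 2) ^ (k - l) := by linarith [abs_nonneg (s'.mat k j)]
      rw [subRow_self, show k - (l - 1) = (k - l) + 1 by omega, pow_succ]
      linarith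
    refine Runs.seq (Runs.assign (by omega) (by rw [ev4]; exact hqb.trans_lt (hpow _ (by omega))) ?_)
    rw [ev4]
    refine Runs.seq ((runs_subRowProg (n := n) (k := k) (l := l) (by simp [hv 0, hn])
      (by simp [hv 2, hk]) (by simp [h3]) hlk.ne hS1 (by simpa using hd.cols) ?_).mono le_rfl ?_)
    · intro j
      have := hsub j
      have := hpow (k - (l - 1)) (by omega)
      simp only [State.mat_setVar, State.setVar_var, if_true]
      linarith
    rintro s₁ ⟨hv₁, hm₁⟩
    simp only [State.mat_setVar, State.setVar_var, if_true] at hm₁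
    have ev3' : (Expr.op .sub (.var 3) (.const 1)).eval s₁ = ((l - 1 : ℕ) : ℤ) := by
      simp [eval, Op.eval, hv₁, h3]; omega
    refine Runs.assign (by omega) ?_ ?_
    · rw [ev3', Nat.abs_cast]
      have := hpow 1 (by omega)
      have : ((l - 1 : ℕ) : ℤ) ≤ n := by exact_mod_cast (by omega : l - 1 ≤ n)
      linarith
    rw [ev3']
    have hdiag₁ := subRow_diag hd hlk hkn q
    refine ⟨⟨l - 1, by omega, by simp, fun v hv2 => ?_, ?_, ?_, ?_, ?_, ?_⟩, ?_⟩
    · have a1 : v ≠ 3 := by omega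
      have a2 : v ≠ 4 := by omega
      have a3 : v ≠ 5 := by omega
      simp [hv₁, a1, a2, a3, hv v hv2]
    · rw [State.mat_setVar, hm₁]; exact hd.subRow hl hlk hkn q
    · intro i; rw [State.mat_setVar, hm₁, hdiag₁, hdiag]
    · intro i hi; rw [State.mat_setVar, hm₁, subRow_of_ne _ _ _ hi, hrow i hi]
    · intro i hi hik
      rw [State.mat_setVar, hm₁, hdiag₁, subRow_self]
      rcases eq_or_ne i l with rfl | hil
      · rw [hq]; exact abs_sub_round_mul_le _ hpos
      · rw [hd.lower l i (by omega) (by omega), mul_zero, sub_zero]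
        exact hred i (by omega) hik
    · intro j; rw [State.mat_setVar, hm₁]; exact hsub j
    · simp [h3]; omega
  · refine ⟨k - 1, by omega, by simp, fun v hv2 => ?_, h.data, fun i => rfl, fun i _ => rfl,
      fun i h1 h2 => by omega, fun j => ?_⟩
    · have a1 : v ≠ 3 := by omega
      simp [a1]
    · rw [show k - (k - 1) = 1 by omega, pow_one, hM]
      have := h.abs_le hn1 k j
      rw [State.mat_setVar]
      linarith
  · simp; omega
  · rintro s' ⟨l, hlk, h3, hv, hd, hdiag, hrow, hred, hb⟩ he
    have hl : l = 0 := by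
      by_contra hc
      have : 0 < l := by omega
      simp [eval, Op.eval, h3, this] at he
    subst hl
    refine ⟨hv, ⟨hd, fun i hi hin => ?_⟩, fun i => ⟨hdiag i, hrow i, fun h1 h2 => hred i h1 h2⟩⟩
    rcases eq_or_ne i k with rfl | hik
    · exact hd.normSq_le hi hin hred
    · rw [hrow i hik]; exact h.short i hi hin

/-- The invariant of the main loop at the row `k`. -/
structure LoopInv (n : ℕ) (x : ℕ → ℤ) (k : ℕ) (s : State) : Prop where
  var_zero : s.var 0 = n
  var_two : s.var 2 = k
  two_le : 2 ≤ k
  le_succ : k ≤ n + 1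
  basis : IsShortBasis n x s.mat
  lovasz : ∀ m, m + 2 < k →
    s.mat (m + 1) (m + 1) ^ 2 ≤ 2 * (s.mat m m * s.mat (m + 2) (m + 2))

theorem IsShortBasis.swapStep {W : ℕ → ℕ → ℤ} (h : IsShortBasis n x W) {m : ℕ} (hm : m + 2 ≤ n)
    (hlov : 4 * (W m m * W (m + 2) (m + 2) + W (m + 2) (m + 1) ^ 2) < 3 * W (m + 1) (m + 1) ^ 2) :
    IsShortBasis n x (swapStep W m) := by
  refine ⟨h.data.swapStep hm hlov, fun i hi hin => ?_⟩
  have hi' := swap_mem_Icc hm hi hin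
  rw [normSq_swapStep hm]
  exact h.short _ hi'.1 hi'.2

/-- Each round decreases the variant: an exchange lowers the level by at least one and `k` by at
most one, and otherwise `k` increases. -/
theorem runs_roundProg {k : ℕ} (hI : LoopInv n x k s) (hkn : k ≤ n)
    (hS : (entryBound n x + 2) ^ (n + 2) ≤ 2 ^ S) :
    Runs S ((2 * n + 2) * n) roundProg s fun s' => ∃ k', LoopInv n x k' s' ∧
      2 * level n s'.mat + (n + 1 - k') < 2 * level n s.mat + (n + 1 - k) := by
  obtain ⟨m, rfl⟩ : ∃ m, k = m + 2 := ⟨k - 2, by have := hI.two_le; omega⟩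
  have hn2 : 2 ≤ n := by omega
  have hn1 : 1 ≤ n := by omega
  have hK : 1 ≤ (2 * n + 2) * n := by nlinarith
  have hS1 := two_mul_add_one_lt hn1 hS
  have hMS := entryBound_add_lt hS
  have hnM := le_entryBound n x
  have hcast : ∀ a : ℕ, a ≤ n + 1 → |(a : ℤ)| < 2 ^ S := fun a ha => by
    rw [Nat.abs_cast]
    have : (a : ℤ) ≤ n + 1 := by exact_mod_cast ha
    linarith
  refine Runs.seq ((runs_reduceProg hI.var_zero hI.var_two hI.two_le hkn hI.basis hS).mono le_rfl ?_)
  rintro s₁ ⟨hv, hb, hr⟩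
  have hlt : ∀ i j, |s₁.mat i j| < 2 ^ S := fun i j => by
    have := hb.abs_le hn1 i j; linarith
  have h0 : s₁.var 0 = n := by rw [hv 0 (by omega), hI.var_zero]
  have h2 : s₁.var 2 = (m + 2 : ℕ) := by rw [hv 2 le_rfl, hI.var_two]
  have hlevel : level n s₁.mat = level n s.mat := level_congr fun i => (hr i).1
  have hlov : ∀ l, l + 2 < m + 2 →
      s₁.mat (l + 1) (l + 1) ^ 2 ≤ 2 * (s₁.mat l l * s₁.mat (l + 2) (l + 2)) := fun l hl => by
    rw [(hr _).1, (hr _).1, (hr _).1]; exact hI.lovasz l hl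
  have hred := (hr (m + 1)).2.2 (by omega) (by omega)
  rw [← hlevel]
  clear hlevel hr hv hI
  obtain ⟨W, hW⟩ : ∃ W, W = s₁.mat := ⟨_, rfl⟩
  rw [← hW] at hb hlt hlov hred ⊢
  -- the tests and assignments between the reduction and the exchange
  have e1 : (Expr.op .sub (.var 2) (.const 1)).eval s₁ = ((m + 1 : ℕ) : ℤ) := by
    simp [eval, Op.eval, h2]; ring
  refine Runs.seq (Runs.assign hK (by rw [e1]; exact hcast _ (by omega)) ?_)
  rw [e1]
  obtain ⟨s₂, hs₂⟩ : ∃ s₂, s₂ = s₁.setVar 3 ((m + 1 : ℕ) : ℤ) := ⟨_, rfl⟩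
  rw [← hs₂]
  have e2 : (entry (.var 2) (.var 3)).eval s₂ = W (m + 2) (m + 1) := by
    rw [eval_entry (i := m + 2) (j := m + 1) (by simp [eval, hs₂, h2]) (by simp [eval, hs₂]),
      hs₂, hW]; rfl
  refine Runs.seq (Runs.assign hK (by rw [e2]; exact hlt _ _) ?_)
  rw [e2]
  obtain ⟨s₃, hs₃⟩ : ∃ s₃, s₃ = s₂.setVar 7 (W (m + 2) (m + 1)) := ⟨_, rfl⟩
  rw [← hs₃]
  have e3 : (entry (.var 2) (.var 2)).eval s₃ = W (m + 2) (m + 2) := by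
    rw [eval_entry (i := m + 2) (j := m + 2) (by simp [eval, hs₃, hs₂, h2])
      (by simp [eval, hs₃, hs₂, h2]), hs₃, hs₂, hW]; rfl
  refine Runs.seq (Runs.assign hK (by rw [e3]; exact hlt _ _) ?_)
  rw [e3]
  obtain ⟨s₄, hs₄⟩ : ∃ s₄, s₄ = s₃.setVar 8 (W (m + 2) (m + 2)) := ⟨_, rfl⟩
  rw [← hs₄]
  have e4 : (entry (.var 3) (.var 3)).eval s₄ = W (m + 1) (m + 1) := by
    rw [eval_entry (i := m + 1) (j := m + 1) (by simp [eval, hs₄, hs₃, hs₂])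
      (by simp [eval, hs₄, hs₃, hs₂]), hs₄, hs₃, hs₂, hW]; rfl
  refine Runs.seq (Runs.assign hK (by rw [e4]; exact hlt _ _) ?_)
  rw [e4]
  obtain ⟨s₅, hs₅⟩ : ∃ s₅, s₅ = s₄.setVar 9 (W (m + 1) (m + 1)) := ⟨_, rfl⟩
  rw [← hs₅]
  have e5 : (entry (.op .sub (.var 3) (.const 1)) (.op .sub (.var 3) (.const 1))).eval s₅ =
      W m m := by
    rw [eval_entry (i := m) (j := m) (by simp [eval, Op.eval, hs₅, hs₄, hs₃, hs₂])
      (by simp [eval, Op.eval, hs₅, hs₄, hs₃, hs₂]), hs₅, hs₄, hs₃, hs₂, hW]; rfl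
  refine Runs.seq (Runs.assign hK (by rw [e5]; exact hlt _ _) ?_)
  rw [e5]
  obtain ⟨s₆, hs₆⟩ : ∃ s₆, s₆ = s₅.setVar 10 (W m m) := ⟨_, rfl⟩
  rw [← hs₆]
  have w0 : s₆.var 0 = n := by simp [hs₆, hs₅, hs₄, hs₃, hs₂, h0]
  have w2 : s₆.var 2 = (m + 2 : ℕ) := by simp [hs₆, hs₅, hs₄, hs₃, hs₂, h2]
  have w3 : s₆.var 3 = (m + 1 : ℕ) := by simp [hs₆, hs₅, hs₄, hs₃, hs₂]
  have w7 : s₆.var 7 = W (m + 2) (m + 1) := by simp [hs₆, hs₅, hs₄, hs₃]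
  have w8 : s₆.var 8 = W (m + 2) (m + 2) := by simp [hs₆, hs₅, hs₄]
  have w9 : s₆.var 9 = W (m + 1) (m + 1) := by simp [hs₆, hs₅]
  have w10 : s₆.var 10 = W m m := by simp [hs₆]
  have wm : s₆.mat = W := by rw [hs₆, hs₅, hs₄, hs₃, hs₂, hW]; rfl
  clear hs₂ hs₃ hs₄ hs₅ hs₆ e1 e2 e3 e4 e5 hW h0 h2
  have hcond : (Expr.op .lt
        (.op .mul (.const 4) (.op .add (.op .mul (.var 10) (.var 8)) (.op .mul (.var 7) (.var 7))))
        (.op .mul (.const 3) (.op .mul (.var 9) (.var 9)))).eval s₆ =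
      if 4 * (W m m * W (m + 2) (m + 2) + W (m + 2) (m + 1) ^ 2) < 3 * W (m + 1) (m + 1) ^ 2
      then 1 else 0 := by
    simp [eval, Op.eval, w7, w8, w9, w10, sq]
  refine Runs.ite hK (fun hc => ?_) (fun hc => ?_)
  · rw [hcond] at hc
    have hL : 4 * (W m m * W (m + 2) (m + 2) + W (m + 2) (m + 1) ^ 2) < 3 * W (m + 1) (m + 1) ^ 2 := by
      by_contra hL; simp [hL] at hc
    have hb' := hb.swapStep hkn hL
    have hK' : 2 * n + 2 ≤ (2 * n + 2) * n := Nat.le_mul_of_pos_right _ (by omega)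
    refine Runs.seq ((runs_swapRowsProg w0 w2 w3 hS1 (by rw [wm]; exact hb.data.cols)
      (fun i j _ => by rw [wm]; exact hlt i j)).mono hK' ?_)
    rintro s₇ ⟨hv₇, hm₇⟩
    rw [wm] at hm₇
    refine Runs.seq ((runs_swapColsProg (S := S) (n := n) (m := m) (W := W) (by rw [hv₇ 0, w0] <;> decide)
      (by rw [hv₇ 2, w2] <;> decide) (by rw [hv₇ 3, w3] <;> decide)
      (by rw [hv₇ 7, w7] <;> decide) (by rw [hv₇ 8, w8] <;> decide)
      (by rw [hv₇ 9, w9] <;> decide) (by rw [hv₇ 10, w10] <;> decide) hm₇ (by omega)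
      (fun i j hi => ?_) hb'.data.rows (fun i j _ => by rw [swapRows_eq]; exact hlt _ _)
      (fun i j _ => ?_)).mono (by nlinarith) ?_)
    · rw [swapRows_eq, Equiv.swap_apply_of_ne_of_ne (by omega) (by omega)]
      exact hb.data.rows i j hi
    · have := hb'.abs_le hn1 i j; linarith
    rintro s₈ ⟨hv₈, hm₈⟩
    have u0 : s₈.var 0 = n := by rw [hv₈ 0, hv₇ 0, w0] <;> decide
    have u2 : s₈.var 2 = (m + 2 : ℕ) := by rw [hv₈ 2, hv₇ 2, w2] <;> decide
    have hlv := level_swapStep_lt hb.data hkn hL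
    have hcond' : (Expr.op .lt (.const 2) (.var 2)).eval s₈ = if 0 < m then 1 else 0 := by
      simp only [eval, Op.eval, u2]
      congr 1
      simp
    -- the Lovász conditions among the rows before `m + 1` are not affected
    have hlov' : ∀ l, l + 2 < m + 1 → swapStep W m (l + 1) (l + 1) ^ 2 ≤
        2 * (swapStep W m l l * swapStep W m (l + 2) (l + 2)) := fun l hl => by
      rw [swapStep_diag hb.data hkn (by omega) (by omega),
        swapStep_diag hb.data hkn (by omega) (by omega),
        swapStep_diag hb.data hkn (by omega) (by omega)]
      exact hlov l (by omega)
    refine Runs.ite hK (fun hc => ?_) (fun hc => ?_)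
    · have hm0 : 0 < m := by
        by_contra hm0; simp [hcond', hm0] at hc
      have e : (Expr.op .sub (.var 2) (.const 1)).eval s₈ = ((m + 1 : ℕ) : ℤ) := by
        simp [eval, Op.eval, u2]; ring
      refine Runs.assign hK (by rw [e]; exact hcast _ (by omega)) ?_
      rw [e]
      refine ⟨m + 1, ⟨by simp [u0], by simp, by omega, by omega, by rw [State.mat_setVar, hm₈]; exact hb',
        by rw [State.mat_setVar, hm₈]; exact hlov'⟩, ?_⟩
      rw [State.mat_setVar, hm₈]
      omega
    · have hm0 : m = 0 := by
        by_contra hm0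
        have : 0 < m := by omega
        simp [hcond', this] at hc
      refine Runs.skip hK ⟨m + 2, ⟨u0, u2, by omega, by omega, by rw [hm₈]; exact hb',
        fun l hl => by omega⟩, ?_⟩
      rw [hm₈]
      omega
  · rw [hcond] at hc
    have hL : 3 * W (m + 1) (m + 1) ^ 2 ≤ 4 * (W m m * W (m + 2) (m + 2) + W (m + 2) (m + 1) ^ 2) := by
      by_contra hL
      rw [if_pos (by omega)] at hc
      omega
    have hsq : 4 * W (m + 2) (m + 1) ^ 2 ≤ W (m + 1) (m + 1) ^ 2 := by
      have := pow_le_pow_left₀ (by positivity) hred 2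
      rw [mul_pow, sq_abs] at this
      linarith
    have e : (Expr.op .add (.var 2) (.const 1)).eval s₆ = ((m + 3 : ℕ) : ℤ) := by
      simp [eval, Op.eval, w2]; ring
    refine Runs.assign hK (by rw [e]; exact hcast _ (by omega)) ?_
    rw [e]
    refine ⟨m + 3, ⟨by simp [w0], by simp, by omega, by omega, by rw [State.mat_setVar, wm]; exact hb, ?_⟩, ?_⟩
    · intro l hl
      rw [State.mat_setVar, wm]
      rcases eq_or_ne l m with rfl | hlm
      · linarith
      · exact hlov l (by omega)
    · rw [State.mat_setVar, wm]
      omega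

theorem runs_lllProg {c : ℕ} (hn : 2 ≤ n) (h0 : s.var 0 = n) (hb : IsShortBasis n x s.mat)
    (hc : volSq n x ≤ 2 ^ c) (hS : (entryBound n x + 2) ^ (n + 2) ≤ 2 ^ S) :
    Runs S ((2 * n + 2) * n * (6 * n * c + n)) lllProg s fun s' =>
      s'.var 0 = n ∧ IsShortBasis n x s'.mat ∧ ∀ m, m + 2 ≤ n →
        s'.mat (m + 1) (m + 1) ^ 2 ≤ 2 * (s'.mat m m * s'.mat (m + 2) (m + 2)) := by
  have hK : 1 ≤ (2 * n + 2) * n := by nlinarith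
  have hMS := entryBound_add_lt hS
  have hnM := le_entryBound n x
  have hn0 : (0 : ℤ) ≤ n := by positivity
  have hKK : 1 ≤ (2 * n + 2) * n * (6 * n * c + n) := Nat.mul_pos hK (by omega)
  have hn2 : (2 : ℤ) ≤ n := by exact_mod_cast hn
  refine Runs.seq (Runs.assign hKK (by simp only [eval]; rw [abs_of_pos (by norm_num)]; linarith) ?_)
  simp only [eval]
  refine Runs.loop (fun s' => ∃ k, LoopInv n x k s')
    (fun s' => 2 * level n s'.mat + (n + 1 - (s'.var 2).toNat)) hK ?_ ?_ ?_ ?_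
  · rintro s' ⟨k, hI⟩ hne
    have hkn : k ≤ n := by
      by_contra hc
      apply hne
      have h1 : ¬ (k : ℤ) < n + 1 := by omega
      simp [eval, Op.eval, hI.var_zero, hI.var_two, h1]
    refine (runs_roundProg hI hkn hS).mono le_rfl ?_
    rintro s'' ⟨k', hI', hlt⟩
    refine ⟨⟨k', hI'⟩, ?_⟩
    rw [hI.var_two, hI'.var_two]
    simpa using hlt
  · exact ⟨2, by simp [h0], by simp, le_rfl, by omega, hb, fun m hm => by omega⟩
  · have := level_le hb.data hc
    simp only [State.mat_setVar, State.setVar_var, if_true]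
    have e : (2 : ℤ).toNat = 2 := rfl
    rw [e]
    have : 6 * n * c = 2 * (3 * n * c) := by ring
    omega
  · rintro s' ⟨k, hI⟩ he
    have hkn : k = n + 1 := by
      by_contra hc
      have := hI.le_succ
      have h1 : (k : ℤ) < n + 1 := by omega
      simp [eval, Op.eval, hI.var_zero, hI.var_two, h1] at he
    exact ⟨hI.var_zero, hI.basis, fun m hm => hI.lovasz m (by omega)⟩

end RAM

/-! ### Initialization and output -/

namespace RAM

open LLL RAM.Expr

variable {S n : ℕ} {s : State} {x : ℕ → ℤ}

theorem runs_weightProg (hn : s.var 0 = n) (hx : ∀ t < n, s.arr 0 t = x t) (hnS : n < 2 ^ S)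
    (hS : weight n x < 2 ^ S) :
    Runs S (n + 1) weightProg s fun s' =>
      s'.var 0 = n ∧ s'.var 1 = weight n x ∧ s'.arr = s.arr := by
  have hsum : ∀ i, 0 ≤ ∑ t ∈ Finset.range i, x t ^ 2 :=
    fun i => Finset.sum_nonneg fun _ _ => sq_nonneg _
  have hmono : ∀ i ≤ n, ∑ t ∈ Finset.range i, x t ^ 2 ≤ ∑ t ∈ Finset.range n, x t ^ 2 :=
    fun i hi => Finset.sum_le_sum_of_subset_of_nonneg (Finset.range_subset_range.2 hi)
      fun _ _ _ => sq_nonneg _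
  have hbd : ∀ a i : ℕ, a ≤ n → i ≤ n →
      |4 ^ a * (1 + ∑ t ∈ Finset.range i, x t ^ 2)| < 2 ^ S := fun a i ha hi => by
    have h1 := hsum i
    have h2 := hmono i hi
    rw [abs_of_nonneg (by positivity)]
    refine lt_of_le_of_lt ?_ hS
    unfold weight
    gcongr
    norm_num
  refine Runs.seq (Runs.assign (by omega) ?_ ?_)
  · have := hbd 0 0 (by omega) (by omega)
    simpa [eval] using this
  simp only [eval]
  refine Runs.seq ((Runs.forLoop (K := 1) (a := 0) (b := n) (m := n + 1)
    (fun j s' => s'.var 5 = j ∧ s'.var 0 = n ∧ s'.arr = s.arr ∧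
      s'.var 1 = 1 + ∑ t ∈ Finset.range j, x t ^ 2) (Q := fun s' => s'.var 0 = n ∧ s'.arr = s.arr ∧
      s'.var 1 = 1 + ∑ t ∈ Finset.range n, x t ^ 2) le_rfl
    (by simp [eval]) (by omega) hnS (by omega) ?_ ?_ ?_ ?_).mono (by omega) ?_)
  · rintro j s' ⟨h5, h0, -⟩
    exact ⟨h5, by simpa [eval] using h0⟩
  · simp [hn]
  · rintro j s' - hj ⟨h5, h0, ha, h1⟩
    have ev : (Expr.op .add (.var 1) (.op .mul (.read 0 (.var 5)) (.read 0 (.var 5)))).eval s' =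
        1 + ∑ t ∈ Finset.range (j + 1), x t ^ 2 := by
      rw [Finset.sum_range_succ]
      simp only [eval, Op.eval, h5, h1, ha, hx j hj]
      ring
    refine Runs.assign le_rfl ?_ ?_
    · rw [ev]; simpa using hbd 0 (j + 1) (by omega) hj
    · rw [ev]
      simp [h5, h0, ha]
  · rintro s' ⟨-, h⟩; exact h
  rintro s₁ ⟨h0, ha, h1⟩
  refine (Runs.forLoop (K := 1) (a := 0) (b := n) (m := n + 1)
    (fun j s' => s'.var 5 = j ∧ s'.var 0 = n ∧ s'.arr = s.arr ∧
      s'.var 1 = 4 ^ j * (1 + ∑ t ∈ Finset.range n, x t ^ 2)) le_rfl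
    (by simp [eval]) (by omega) hnS (by omega) ?_ ?_ ?_ ?_).mono (by omega) fun _ h => h
  · rintro j s' ⟨h5, h0, -⟩
    exact ⟨h5, by simpa [eval] using h0⟩
  · simp [h0, h1, ha]
  · rintro j s' - hj ⟨h5, h0, ha, h1⟩
    have ev : (Expr.op .mul (.const 4) (.var 1)).eval s' =
        4 ^ (j + 1) * (1 + ∑ t ∈ Finset.range n, x t ^ 2) := by
      simp only [eval, Op.eval, h1]
      ring
    refine Runs.assign le_rfl ?_ ?_
    · rw [ev]; exact hbd (j + 1) n hj le_rfl
    · rw [ev]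
      simp [h5, h0, ha]
  · rintro s' ⟨-, h0, ha, h1⟩
    exact ⟨h0, h1, ha⟩

theorem runs_initRowProg {i : ℕ} (hi : 1 ≤ i) (hin : i ≤ n) (h0 : s.var 0 = n)
    (h1 : s.var 1 = weight n x) (h3 : s.var 3 = i) (h6 : s.var 6 = initData n x (i - 1) (i - 1))
    (hx : ∀ t < n, s.arr 0 t = x t) (hrow : ∀ j, s.mat i j = 0) (hnS : n < 2 ^ S)
    (hS : ∀ i j, |initData n x i j| < 2 ^ S) :
    Runs S (n + 1) initRowProg s fun s' =>
      s'.var 0 = n ∧ s'.var 1 = weight n x ∧ s'.var 3 = i ∧ s'.var 6 = initData n x i i ∧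
      s'.arr 0 = s.arr 0 ∧ ∀ r c, s'.mat r c = if r = i then initData n x r c else s.mat r c := by
  obtain ⟨a, rfl⟩ : ∃ a, i = a + 1 := ⟨i - 1, by omega⟩
  have ev6 : (Expr.op .add (.var 6) (.op .mul (.var 1)
      (.op .mul (.read 0 (.op .sub (.var 3) (.const 1)))
        (.read 0 (.op .sub (.var 3) (.const 1)))))).eval s = initData n x (a + 1) (a + 1) := by
    have e : s.var 3 - 1 = (a : ℤ) := by rw [h3]; push_cast; ring
    simp only [eval, Op.eval, e, h1, h6, hx a (by omega), Nat.add_sub_cancel]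
    rw [initData_diag (by omega), initData_diag hin, Finset.sum_range_succ]
    ring
  refine Runs.seq (Runs.assign (by omega) (by rw [ev6]; exact hS _ _) ?_)
  rw [ev6]
  refine Runs.seq ((Runs.forLoop (K := 1) (a := 1) (b := a + 1) (m := n + 1)
    (fun j s' => s'.var 5 = j ∧ s'.var 0 = n ∧ s'.var 1 = weight n x ∧ s'.var 3 = (a + 1 : ℕ) ∧
      s'.var 6 = initData n x (a + 1) (a + 1) ∧ s'.arr 0 = s.arr 0 ∧
      ∀ r c, s'.mat r c = if r = a + 1 ∧ 1 ≤ c ∧ c < j then initData n x r c else s.mat r c) le_rfl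
    (by simp [eval]) (by omega) (by omega) (by omega) ?_ ?_ ?_ (fun _ h => h)).mono (by omega) ?_)
  · rintro j s' ⟨h5, -, -, h3, -⟩
    exact ⟨h5, by simpa [eval] using h3⟩
  · refine ⟨by simp, by simp [h0], by simp [h1], by simp [h3], by simp, by simp, fun r c => ?_⟩
    rw [if_neg (by omega)]; rfl
  · rintro j s' hj hja ⟨h5, h0, h1, h3, h6, ha, hm⟩
    have e3 : s'.var 3 - 1 = (a : ℤ) := by rw [h3]; push_cast; ring
    have e5 : s'.var 5 - 1 = ((j - 1 : ℕ) : ℤ) := by rw [h5]; omega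
    have ev : (Expr.op .mul (.op .mul (.var 1) (.read 0 (.op .sub (.var 3) (.const 1))))
            (.read 0 (.op .sub (.var 5) (.const 1)))).eval s' = initData n x (a + 1) j := by
      simp only [eval, Op.eval, e3, e5, h1, ha, hx a (by omega), hx (j - 1) (by omega)]
      simp [initData, hja]
      intro h
      omega
    refine Runs.store le_rfl (by rw [ev]; exact hS _ _) ?_
    rw [ev, eval_addr (i := a + 1) (j := j) (by simpa [eval] using h3) (by simpa [eval] using h5)]
    refine ⟨by simpa using h5, by simp, by simpa using h0, by simpa using h1, by simpa using h3,
      by simpa using h6, ?_, fun r c => ?_⟩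
    · ext t; simp [State.setArr_arr, ha]
    · rw [State.mat_setVar, State.mat_setArr, hm]
      split_ifs with g1 g2 g3 g4
      · rw [g1.1, g1.2]
      · omega
      · rfl
      · omega
      · omega
      · rfl
  rintro s₁ ⟨-, h0, h1, h3, h6, ha, hm⟩
  refine Runs.seq (Runs.store (by omega) (by simpa [eval, h6] using hS _ _) ?_)
  rw [eval_addr (i := a + 1) (j := a + 1) (by simpa [eval] using h3) (by simpa [eval] using h3)]
  refine Runs.store (by omega) ?_ ?_
  · simpa [eval, initData] using hS 0 0
  rw [eval_addr (i := a + 1) (j := n + (a + 1)) (by simpa [eval] using h3)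
    (by simp [eval, Op.eval, h0, h3])]
  refine ⟨by simpa using h0, by simpa using h1, by simpa using h3, by simpa using h6, ?_,
    fun r c => ?_⟩
  · ext t; simp [State.setArr_arr, ha]
  · rw [State.mat_setArr, State.mat_setArr, hm]
    simp only [eval, h6]
    by_cases hr : r = a + 1
    · subst hr
      have n1 : ¬ (n < a + 1) := by omega
      simp only [true_and, if_true, hrow]
      rcases Nat.eq_zero_or_pos c with rfl | hc
      · simp [initData]
      rcases lt_trichotomy c (a + 1) with hlt | rfl | hgt
      · rw [if_neg (by omega), if_neg (by omega), if_pos (by omega)]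
      · rw [if_neg (by omega), if_pos rfl]
      · have n2 : ¬ c < a + 1 := by omega
        have n3 : c ≠ a + 1 := by omega
        have n4 : c ≠ 0 := by omega
        simp [initData, n1, n2, n3, n4]
    · simp [hr]

theorem runs_initProg (hn : 1 ≤ n) (h0 : s.var 0 = n) (hx : ∀ t < n, s.arr 0 t = x t)
    (hmat : ∀ i j, s.mat i j = 0) (hx0 : ∃ t < n, x t ≠ 0)
    (hS : (entryBound n x + 2) ^ (n + 2) ≤ 2 ^ S) :
    Runs S ((n + 1) * (n + 2)) initProg s fun s' => s'.var 0 = n ∧ IsShortBasis n x s'.mat := by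
  have hb : IsShortBasis n x (initData n x) :=
    ⟨isBasisData_initData hx0, fun i hi hin => normSq_initData_le hi hin⟩
  have hMS := entryBound_add_lt hS
  have hS1 := two_mul_add_one_lt hn hS
  have hI : ∀ i j, |initData n x i j| < 2 ^ S := fun i j => by
    have := hb.abs_le hn i j; linarith
  have hw : weight n x < 2 ^ S := by
    have h1 := volSq_le_entryBound hn x
    obtain ⟨t, ht, hxt⟩ := hx0
    have h2 : x t ^ 2 ≤ ∑ t ∈ Finset.range n, x t ^ 2 :=
      Finset.single_le_sum (f := fun t => x t ^ 2) (fun _ _ => sq_nonneg _) (Finset.mem_range.2 ht)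
    have h3 := sq_pos_of_ne_zero hxt
    have h4 := weight_pos n x
    have h5 : weight n x ≤ volSq n x := by unfold volSq; nlinarith
    linarith
  refine Runs.seq ((runs_weightProg h0 hx (by omega) hw).mono (by nlinarith) ?_)
  rintro s₁ ⟨h0, h1, ha⟩
  have hmat₁ : ∀ i j, s₁.mat i j = 0 := fun i j => by rw [State.mat, ha]; exact hmat i j
  have h11 : |(1 : ℤ)| < 2 ^ S := by simpa [initData] using hI 0 0
  refine Runs.seq (Runs.store (by nlinarith) (by simpa [eval] using h11) ?_)
  rw [eval_addr (i := 0) (j := 0) (by simp [eval]) (by simp [eval])]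
  refine Runs.seq (Runs.assign (by nlinarith) (by simpa [eval] using h11) ?_)
  simp only [eval]
  refine (Runs.forLoop (K := n + 1) (a := 1) (b := n + 1) (m := n + 2)
    (fun i s' => s'.var 3 = i ∧ s'.var 0 = n ∧ s'.var 1 = weight n x ∧
      s'.var 6 = initData n x (i - 1) (i - 1) ∧ s'.arr 0 = s.arr 0 ∧
      ∀ r c, s'.mat r c = if r < i then initData n x r c else 0) (by omega)
    (by simp [eval]) (by omega) (by omega) (by omega) ?_ ?_ ?_ ?_).mono le_rfl fun _ h => h
  · rintro i s' ⟨h3, h0, -⟩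
    exact ⟨h3, by simp [eval, Op.eval, h0]⟩
  · refine ⟨by simp, by simp [h0], by simp [h1], by simp [initData], ?_, fun r c => ?_⟩
    · ext t; simp [State.setArr_arr, ha]
    · rw [State.mat_setVar, State.mat_setVar, State.mat_setArr, hmat₁]
      rcases Nat.eq_zero_or_pos r with rfl | hr
      · simp [initData]
      · rw [if_neg (by omega), if_neg (by omega)]
  · rintro i s' hi hin ⟨h3, h0, h1, h6, ha', hm⟩
    refine (runs_initRowProg hi (by omega) h0 h1 h3 h6 (fun t ht => by rw [ha', hx t ht])
      (fun j => by rw [hm, if_neg (by omega)]) (by omega) hI).mono le_rfl ?_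
    rintro s'' ⟨g0, g1, g3, g6, ga, gm⟩
    refine ⟨g3, by simp, by simp [g0], by simp [g1], by simp [g6], by simp [ga, ha'],
      fun r c => ?_⟩
    rw [State.mat_setVar, gm, hm]
    split_ifs <;> first | rfl | omega
  · rintro s' ⟨-, h0, -, -, -, hm⟩
    refine ⟨h0, ?_⟩
    have : s'.mat = initData n x := by
      ext r c
      rw [hm]
      split_ifs with hr
      · rfl
      · rw [hb.data.rows r c (by omega)]
    rw [this]
    exact hb

theorem runs_outputProg (h0 : s.var 0 = n) (hnS : n < 2 ^ S) (hB : ∀ j, |s.mat 1 j| < 2 ^ S) :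
    Runs S (n + 1) outputProg s fun s' => ∀ t < n, s'.arr 1 t = s.mat 1 (n + 1 + t) := by
  refine (Runs.forLoop (K := 1) (a := 0) (b := n) (m := n + 1)
    (fun j s' => s'.var 5 = j ∧ s'.var 0 = n ∧ s'.mat = s.mat ∧
      ∀ t < j, s'.arr 1 t = s.mat 1 (n + 1 + t)) le_rfl
    (by simp [eval]) (by omega) hnS (by omega) ?_ ?_ ?_ ?_).mono (by omega) fun _ h => h
  · rintro j s' ⟨h5, h0, -⟩
    exact ⟨h5, by simpa [eval] using h0⟩
  · exact ⟨by simp, by simp [h0], by simp, fun t ht => by omega⟩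
  · rintro j s' - hj ⟨h5, h0, hm, ha⟩
    have ev : (entry (.const 1) (.op .add (.op .add (.var 0) (.const 1)) (.var 5))).eval s' =
        s.mat 1 (n + 1 + j) := by
      rw [eval_entry (i := 1) (j := n + 1 + j) (by simp [eval]) (by simp [eval, Op.eval, h0, h5]),
        hm]
    refine Runs.store le_rfl (by rw [ev]; exact hB _) ?_
    rw [ev]
    refine ⟨by simpa using h5, by simp, by simpa using h0, ?_, fun t ht => ?_⟩
    · rw [State.mat_setVar, State.mat_setArr_of_ne _ (by decide), hm]
    · simp only [State.setVar_arr, State.setArr_arr, eval, h5, true_and, Nat.cast_inj]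
      split_ifs with h
      · rw [h]
      · exact ha t (by omega)
  · rintro s' ⟨-, -, -, ha⟩; exact ha

theorem runs_shortRelationProg {c : ℕ} (hn : 2 ≤ n) (h0 : s.var 0 = n)
    (hx : ∀ t < n, s.arr 0 t = x t) (hmat : ∀ i j, s.mat i j = 0) (hx0 : ∃ t < n, x t ≠ 0)
    (hc : volSq n x ≤ 2 ^ c) (hS : (entryBound n x + 2) ^ (n + 2) ≤ 2 ^ S) :
    Runs S ((2 * n + 2) * n * (6 * n * c + n)) shortRelationProg s fun s' =>
      ∃ W, IsShortBasis n x W ∧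
        (∀ m, m + 2 ≤ n → W (m + 1) (m + 1) ^ 2 ≤ 2 * (W m m * W (m + 2) (m + 2))) ∧
        ∀ t < n, s'.arr 1 t = W 1 (n + 1 + t) := by
  have hMS := entryBound_add_lt hS
  have hS1 := two_mul_add_one_lt (by omega) hS
  have hle : (n + 1) * (n + 2) ≤ (2 * n + 2) * n * (6 * n * c + n) := by
    calc (n + 1) * (n + 2) ≤ (n + 1) * (2 * n * n) := by gcongr; nlinarith
      _ = (2 * n + 2) * n * n := by ring
      _ ≤ _ := by gcongr; omega
  refine Runs.seq ((runs_initProg (by omega) h0 hx hmat hx0 hS).mono hle ?_)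
  rintro s₁ ⟨h0, hb⟩
  refine Runs.seq ((runs_lllProg hn h0 hb hc hS).mono le_rfl ?_)
  rintro s₂ ⟨h0, hb, hlov⟩
  refine (runs_outputProg h0 (by omega) fun j => ?_).mono (le_trans ?_ hle) fun s' h =>
    ⟨_, hb, hlov, h⟩
  · have := hb.abs_le (by omega) 1 j; linarith
  · nlinarith

/-! ### The size of the numbers -/

theorem bdd_input {n : ℕ} (x : Fin n → ℤ) (h : n + bitLength x ≤ S) : (input x).Bdd S := by
  refine ⟨fun v => ?_, fun a i => ?_⟩
  · simp only [input]
    split_ifs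
    · rw [bitSize_le_iff, Nat.abs_cast]
      exact_mod_cast (Nat.lt_two_pow_self (n := n)).trans_le (Nat.pow_le_pow_right (by norm_num) (by omega))
    · simp [bitSize]
  · simp only [input]
    split_ifs with hi
    · have : bitSize (x ⟨i.toNat, by omega⟩) ≤ bitLength x :=
        Finset.single_le_sum (f := fun i => bitSize (x i)) (fun _ _ => Nat.zero_le _)
          (Finset.mem_univ _)
      omega
    · simp [bitSize]

/-- The input vector, extended by `0`. -/
def extend {n : ℕ} (x : Fin n → ℤ) : ℕ → ℤ := fun t => if h : t < n then x ⟨t, h⟩ else 0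

theorem extend_val {n : ℕ} (x : Fin n → ℤ) (i : Fin n) : extend x i = x i := by
  simp [extend]

theorem one_add_sum_sq_le {n : ℕ} (x : Fin n → ℤ) :
    1 + ∑ t ∈ Finset.range n, extend x t ^ 2 ≤ 4 ^ (n + bitLength x) := by
  rw [← Fin.sum_univ_eq_sum_range (fun t => extend x t ^ 2) n]
  simp only [extend_val]
  have h1 : ∀ i, x i ^ 2 ≤ 4 ^ bitLength x := fun i => by
    have h2 := abs_lt_two_pow_bitSize (x i)
    have h3 : bitSize (x i) ≤ bitLength x :=
      Finset.single_le_sum (f := fun i => bitSize (x i)) (fun _ _ => Nat.zero_le _)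
        (Finset.mem_univ _)
    calc x i ^ 2 = |x i| ^ 2 := (sq_abs _).symm
      _ ≤ (2 ^ bitSize (x i)) ^ 2 := by gcongr
      _ ≤ (2 ^ bitLength x) ^ 2 := by gcongr; norm_num
      _ = 4 ^ bitLength x := by rw [← pow_mul, mul_comm, pow_mul]; norm_num
  have h2 : ∑ i, x i ^ 2 ≤ n * 4 ^ bitLength x := by
    calc ∑ i, x i ^ 2 ≤ ∑ _i : Fin n, (4 : ℤ) ^ bitLength x := Finset.sum_le_sum fun i _ => h1 i
      _ = _ := by simp
  have h3 : (n : ℤ) + 1 ≤ 4 ^ n := by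
    have : n < 4 ^ n := Nat.lt_pow_self (by norm_num)
    exact_mod_cast this
  have h4 : (1 : ℤ) ≤ 4 ^ bitLength x := one_le_pow₀ (by norm_num)
  rw [pow_add]
  nlinarith

theorem volSq_extend_le {n : ℕ} (x : Fin n → ℤ) :
    volSq n (extend x) ≤ 2 ^ (6 * (n + bitLength x)) := by
  have h1 := one_add_sum_sq_le x
  have h0 : 0 ≤ ∑ t ∈ Finset.range n, extend x t ^ 2 := Finset.sum_nonneg fun _ _ => sq_nonneg _
  have h2 : (4 : ℤ) ^ n ≤ 4 ^ (n + bitLength x) := pow_le_pow_right₀ (by norm_num) (by omega)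
  have h3 := weight_pos n (extend x)
  calc volSq n (extend x)
      ≤ weight n (extend x) * (1 + ∑ t ∈ Finset.range n, extend x t ^ 2) := by
        unfold volSq; linarith
    _ = 4 ^ n * (1 + ∑ t ∈ Finset.range n, extend x t ^ 2) *
        (1 + ∑ t ∈ Finset.range n, extend x t ^ 2) := by rw [weight]
    _ ≤ 4 ^ (n + bitLength x) * 4 ^ (n + bitLength x) * 4 ^ (n + bitLength x) := by gcongr
    _ = _ := by
        rw [show (4 : ℤ) = 2 ^ 2 by norm_num, ← pow_mul, ← pow_add, ← pow_add]; congr 1; ring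

theorem entryBound_extend_le {n : ℕ} (hn : 2 ≤ n) (x : Fin n → ℤ) :
    entryBound n (extend x) + 2 ≤ 2 ^ (20 * (n + bitLength x)) := by
  have h1 := volSq_extend_le x
  have h2 := one_le_volSq n (extend x)
  obtain ⟨N, hN⟩ : ∃ N, N = n + bitLength x := ⟨_, rfl⟩
  rw [← hN] at h1 ⊢
  have h3 : (n : ℤ) ≤ 2 ^ N := by
    have : n < 2 ^ N := by
      calc n < 2 ^ n := Nat.lt_two_pow_self
        _ ≤ 2 ^ N := Nat.pow_le_pow_right (by norm_num) (by omega)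
    exact_mod_cast this.le
  have h4 : entryBound n (extend x) ≤ 2 ^ (19 * N) := by
    calc entryBound n (extend x) ≤ 2 ^ N * (2 ^ (6 * N)) ^ 3 := by unfold entryBound; gcongr
      _ = _ := by rw [← pow_mul, ← pow_add]; congr 1; ring
  have h5 : (4 : ℤ) ≤ 2 ^ N := by
    calc (4 : ℤ) = 2 ^ 2 := by norm_num
      _ ≤ 2 ^ N := pow_le_pow_right₀ (by norm_num) (by omega)
  have h6 : (1 : ℤ) ≤ 2 ^ (19 * N) := one_le_pow₀ (by norm_num)
  rw [show 20 * N = 19 * N + N by ring, pow_add]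
  nlinarith

/-- The number of bits that suffices for all numbers in the run on an input of size `N`. -/
def wordLength (N : ℕ) : ℕ := 20 * N * (N + 2)

theorem entryBound_pow_le {n : ℕ} (hn : 2 ≤ n) (x : Fin n → ℤ) :
    (entryBound n (extend x) + 2) ^ (n + 2) ≤ 2 ^ wordLength (n + bitLength x) := by
  have h1 := entryBound_extend_le hn x
  have h0 := le_entryBound n (extend x)
  calc (entryBound n (extend x) + 2) ^ (n + 2) ≤ (2 ^ (20 * (n + bitLength x))) ^ (n + 2) :=
        pow_le_pow_left₀ (by omega) h1 _
    _ = 2 ^ (20 * (n + bitLength x) * (n + 2)) := by rw [← pow_mul]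
    _ ≤ _ := pow_le_pow_right₀ (by norm_num) (by unfold wordLength; gcongr; omega)

/-- The polynomial bounding the running time. -/
noncomputable def timeBound : Polynomial ℕ :=
  (2 * .X + 2) * .X * (6 * .X * (6 * .X) + .X) * .C shortRelationProg.wt *
    (20 * .X * (.X + 2) + 1) ^ 2

/-- The run of the program on an arbitrary nonzero input: it takes polynomial time, and the output
is the first vector of a basis satisfying the Lovász conditions. -/
theorem exec_shortRelationProg {n : ℕ} (hn : 2 ≤ n) (x : Fin n → ℤ) (hx : x ≠ 0) :
    ∃ s t, Exec shortRelationProg (input x) s t ∧ t ≤ timeBound.eval (n + bitLength x) ∧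
      ∃ W, IsShortBasis n (extend x) W ∧
        (∀ m, m + 2 ≤ n → W (m + 1) (m + 1) ^ 2 ≤ 2 * (W m m * W (m + 2) (m + 2))) ∧
        ∀ i : Fin n, output n s i = W 1 (n + 1 + i) := by
  obtain ⟨i, hi⟩ := Function.ne_iff.1 hx
  obtain ⟨s, t, he, ht, -, W, hb, hlov, ho⟩ := runs_shortRelationProg
    (S := wordLength (n + bitLength x)) (s := input x) (x := extend x) hn (by simp [input])
    (fun t ht => by simp [input, extend, ht])
    (fun i j => by simp [State.mat, input]) ⟨i, i.2, by rwa [extend_val]⟩ (volSq_extend_le x)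
    (entryBound_pow_le hn x) (bdd_input x (by unfold wordLength; nlinarith))
  refine ⟨s, t, he, ht.trans ?_, W, hb, hlov, fun i => ho i i.2⟩
  obtain ⟨N, hN⟩ : ∃ N, N = n + bitLength x := ⟨_, rfl⟩
  have hnN : n ≤ N := by omega
  rw [← hN]
  simp only [timeBound, Polynomial.eval_mul, Polynomial.eval_add, Polynomial.eval_pow,
    Polynomial.eval_X, Polynomial.eval_C, Polynomial.eval_one, Polynomial.eval_ofNat, wordLength]
  gcongr

end RAM

/-! ### Small integer relations -/

open RAM LLL in
theorem mainTheorem4 :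
    ∃ (p : RAM.Prog) (P : Polynomial ℕ),
      ∀ (n : ℕ), 2 ≤ n → ∀ (x : Fin n → ℤ), x ≠ 0 → ∀ (d : ℕ),
        (d : ℝ) > (2 : ℝ) ^ (((n : ℝ) - 2) / 4) *
            (‖(WithLp.toLp 2 (fun i => (x i : ℝ)) : EuclideanSpace ℝ (Fin n))‖ /
              ((Finset.univ.gcd x : ℤ) : ℝ)) ^ (1 / ((n : ℝ) - 1)) - 1 →
        ∃ (s : RAM.State) (t : ℕ),
          RAM.Exec p (RAM.input x) s t ∧
          t ≤ P.eval (n + RAM.bitLength x) ∧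
          RAM.output n s ≠ 0 ∧
          (∀ i, RAM.output n s i ∈ Set.Icc (-(d : ℤ)) (d : ℤ)) ∧
          RAM.output n s ⬝ᵥ x = 0 := by
  refine ⟨shortRelationProg, timeBound, fun n hn x hx d hd => ?_⟩
  obtain ⟨s, t, he, ht, W, hb, hlov, ho⟩ := exec_shortRelationProg hn x hx
  refine ⟨s, t, he, ht, ?_, fun i => ?_, ?_⟩
  · obtain ⟨t, ht, hne⟩ := exists_coord_ne_zero hb.data (by omega)
    exact Function.ne_iff.2 ⟨⟨t, ht⟩, by rw [ho]; exact hne⟩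
  · obtain ⟨g, hg⟩ : ∃ g, g = Finset.univ.gcd x := ⟨_, rfl⟩
    have hg0 : 0 < g := by
      have h1 : 0 ≤ g := by
        rw [hg, ← Finset.normalize_gcd]; exact Int.nonneg_of_normalize_eq_self (by simp)
      refine lt_of_le_of_ne h1 fun h0 => hx ?_
      rw [hg] at h0
      exact funext fun i => Finset.gcd_eq_zero_iff.1 h0.symm i (Finset.mem_univ i)
    have hdvd : ∀ t < n, g ∣ extend x t := fun t ht => by
      rw [hg, extend, dif_pos ht]; exact Finset.gcd_dvd (Finset.mem_univ _)
    have key := coord_pow_le hb.data hn hlov hdvd i.2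
    rw [← ho i, ← Fin.sum_univ_eq_sum_range (fun t => extend x t ^ 2) n] at key
    simp only [extend_val] at key
    rw [Set.mem_Icc, ← abs_le]
    by_contra hc
    push Not at hc
    obtain ⟨r, hr⟩ : ∃ r, r = ‖(WithLp.toLp 2 (fun i => (x i : ℝ)) : EuclideanSpace ℝ (Fin n))‖ :=
      ⟨_, rfl⟩
    have hr2 : r ^ 2 = ∑ i, (x i : ℝ) ^ 2 := by
      rw [hr, EuclideanSpace.norm_sq_eq]
      simp
    have hr0 : 0 ≤ r := by rw [hr]; exact norm_nonneg _
    rw [← hr, ← hg] at hd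
    have hgR : (0 : ℝ) < g := by exact_mod_cast hg0
    have hlt : (2 : ℝ) ^ (((n : ℝ) - 2) / 4) * (r / g) ^ (1 / ((n : ℝ) - 1)) <
        |(output n s i : ℝ)| := by
      have : (d : ℝ) + 1 ≤ |(output n s i : ℝ)| := by exact_mod_cast hc
      linarith
    have hpow := pow_lt_pow_left₀ hlt (by positivity) (show 4 * (n - 1) ≠ 0 by omega)
    have hn1 : ((n - 1 : ℕ) : ℝ) = n - 1 := by push_cast [show 1 ≤ n by omega]; ring
    have hn2 : ((n - 2 : ℕ) : ℝ) = n - 2 := by push_cast [hn]; ring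
    have hn0 : (n : ℝ) - 1 ≠ 0 := by
      rw [← hn1]; exact_mod_cast (by omega : n - 1 ≠ 0)
    have e1 : ((2 : ℝ) ^ (((n : ℝ) - 2) / 4)) ^ (4 * (n - 1)) = 2 ^ ((n - 1) * (n - 2)) := by
      rw [← Real.rpow_natCast, ← Real.rpow_mul (by norm_num), ← Real.rpow_natCast]
      congr 1
      push_cast
      rw [hn1, hn2]
      ring
    have e2 : ((r / g) ^ (1 / ((n : ℝ) - 1))) ^ (4 * (n - 1)) = (r / g) ^ 4 := by
      rw [← Real.rpow_natCast, ← Real.rpow_mul (by positivity), ← Real.rpow_natCast]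
      congr 1
      push_cast
      rw [hn1]
      field_simp
    rw [mul_pow, e1, e2] at hpow
    have keyR : |(output n s i : ℝ)| ^ (4 * (n - 1)) * (g : ℝ) ^ 4 ≤
        2 ^ ((n - 1) * (n - 2)) * (∑ i, (x i : ℝ) ^ 2) ^ 2 := by exact_mod_cast key
    rw [← hr2] at keyR
    have e3 : (r / g) ^ 4 * (g : ℝ) ^ 4 = (r ^ 2) ^ 2 := by
      field_simp
    have := mul_lt_mul_of_pos_right hpow (show (0 : ℝ) < (g : ℝ) ^ 4 by positivity)
    rw [mul_assoc, e3] at this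
    linarith
  · have h1 := orthogonal_of_reduced hb.data hlov (j := 1) le_rfl (by omega)
    rw [← Fin.sum_univ_eq_sum_range (fun t => W 1 (n + 1 + t) * extend x t) n] at h1
    rw [dotProduct, ← h1]
    exact Finset.sum_congr rfl fun i _ => by rw [ho, extend_val]
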